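/- Let $\overline{\mathbb{C}}$ be the Riemann sphere. For a domain (non-empty connected open set) $B\subset\overline{\mathbb{C}}$ and a point $a\in B$ let $g_B(\cdot,a)$ be the (generalized) Green function of $B$ with pole at $a$, and let $r(B,a)$ be the inner radius of $B$ with respect to $a$, i.e. $\log r(B,a)=\lim_{z\to a}\bigl(g_B(z,a)+\log|z-a|\bigr)$ if $a\neq\infty$ and $\log r(B,\infty)=\lim_{z\to\infty}\bigl(g_B(z,\infty)-\log|z|\bigr)$ (with $r(B,a)=+\infty$ if $B$ has no Green function). A polycylindrical domain in $\overline{\mathbb{C}}^{\infty}=\overline{\mathbb{C}}\times\overline{\mathbb{C}}\times\cdots$ is a product $\mathbb{B}=B_1\times B_2\times\cdots$ of arbitrary domains $B_k\subset\overline{\mathbb{C}}$ (its coordinate domains); its generalized inner radius at $\mathbb{A}=\{a_k\}_{k=1}^{\infty}\in\mathbb{B}$ is the sequence $\mathbb{R}(\mathbb{B},\mathbb{A})=\{r(B_k,a_k)\}_{k=1}^{\infty}$. Products of and inequalities between sequences are understood coordinatewise; $\mathbf{1}=(1,1,\ldots)$, $\mathbb{O}=(0,0,\ldots)$, $\infty=(\infty,\infty,\ldots)$.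 Let $\Lambda(\mathbb{O},\infty)$ be the class of all pairs $(\mathbb{B}_1,\mathbb{B}_2)$ of polycylindrical domains $\mathbb{B}_s=B^{(s)}_1\times B^{(s)}_2\times\cdots$ such that $\mathbb{O}\in\mathbb{B}_1$, $\infty\in\mathbb{B}_2$ and $B^{(1)}_k\cap B^{(2)}_k=\varnothing$ for every $k$. **Theorem.** For every pair $(\mathbb{B}_1,\mathbb{B}_2)\in\Lambda(\mathbb{O},\infty)$ all inner radii $r(B^{(1)}_k,0)$ and $r(B^{(2)}_k,\infty)$ are positive and finite, and $$\mathbb{R}(\mathbb{B}_1,\mathbb{O})\cdot\mathbb{R}(\mathbb{B}_2,\infty)\le\mathbf{1}.$$ Equality is attained for the pair in $\Lambda(\mathbb{O},\infty)$ in which $\mathbb{B}_1=\mathbb{U}^{\infty}=\{\mathbb{Z}=\{z_k\}_{k=1}^{\infty}\in\mathbb{C}^{\infty}:|z_k|<1\text{ for all }k\}$ is the unit polydisc and $\mathbb{B}_2$ is the image of $\mathbb{B}_1$ under the coordinatewise map $\mathbb{Z}\mapsto\mathbf{1}/\mathbb{Z}$ (with $1/0=\infty$). -/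

import Mathlib

noncomputable section

namespace PolyCyl

open Filter Topology
open scoped ENNReal

/-- The Riemann sphere, as the one-point compactification of the complex plane. -/
abbrev Sphere : Type := OnePoint ℂ

/-- The parametrisation of the sphere minus the origin by `w ↦ 1 / w`, with `1 / 0 = ∞`. -/
def invChart (w : ℂ) : Sphere := if w = 0 then OnePoint.infty else ((w⁻¹ : ℂ) : Sphere)

/-- The map `z ↦ 1 / z` of the Riemann sphere onto itself, with `1 / 0 = ∞` and `1 / ∞ = 0`. -/
def sphereInv : Sphere → Sphere
  | none => ((0 : ℂ) : Sphere)
  | some z => invChart z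

/-- The local parameter centred at `a`: the point `a + ζ` if `a` is finite,
and the point `1 / ζ` if `a = ∞`. -/
def localParam : Sphere → ℂ → Sphere
  | none => invChart
  | some a => fun ζ => ((a + ζ : ℂ) : Sphere)

/-- Real-valued subharmonic functions on a subset `U` of the plane (used for open `U`):
upper semicontinuous functions that are dominated by their mean over the boundary of each
closed disc contained in `U`. For such functions integrability over these circles is automatic;
it is recorded so that the mean is a genuine integral. -/
structure IsSubharmonicOn (u : ℂ → ℝ) (U : Set ℂ) : Prop where
  usc : UpperSemicontinuousOn u U
  circleIntegrable : ∀ (z : ℂ) (r : ℝ), 0 < r → Metric.closedBall z r ⊆ U →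
    CircleIntegrable u z r
  le_circleAverage : ∀ (z : ℂ) (r : ℝ), 0 < r → Metric.closedBall z r ⊆ U →
    u z ≤ Real.circleAverage u z r

/-- Subharmonicity on an open subset of the Riemann sphere: subharmonicity in the two standard
charts `z` and `1 / z`. -/
def IsSubharmonicOnSphere (v : Sphere → ℝ) (W : Set Sphere) : Prop :=
  IsSubharmonicOn (fun z : ℂ => v (z : Sphere)) ((fun z : ℂ => (z : Sphere)) ⁻¹' W) ∧
  IsSubharmonicOn (fun w : ℂ => v (invChart w)) (invChart ⁻¹' W)

/-- The Perron family of a domain `B` of the sphere with pole `a`: the nonnegative functions `v`,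
subharmonic on `B \ {a}`, that vanish outside a compact subset of `B` and have at most a
logarithmic pole at `a`, that is, `v + log |ζ|` is bounded above near `a` in the local
parameter `ζ`. -/
structure IsGreenMinorant (B : Set Sphere) (a : Sphere) (v : Sphere → ℝ) : Prop where
  nonneg : ∀ z, 0 ≤ v z
  subharmonic : IsSubharmonicOnSphere v (B \ {a})
  compact_support : ∃ K : Set Sphere, IsCompact K ∧ K ⊆ B ∧ ∀ z, z ∉ K → v z = 0
  log_pole : ∃ M : ℝ, ∀ᶠ ζ in 𝓝[≠] (0 : ℂ), v (localParam a ζ) + Real.log ‖ζ‖ ≤ M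

/-- The (generalized) Green function `g_B(z, a)` of a domain `B` of the sphere with pole `a`:
the upper envelope of the Perron family. It is identically `⊤` on `B` if `B` has no
Green function. -/
def greenFunction (B : Set Sphere) (a z : Sphere) : EReal :=
  ⨆ v : {v : Sphere → ℝ // IsGreenMinorant B a v}, ((v.1 z : ℝ) : EReal)

/-- The inner radius `r(B, a)` of a domain `B` of the sphere at a point `a ∈ B`:
`log r(B, a) = lim (g_B(z, a) + log |ζ|)` as `z → a`, where `ζ = z - a` if `a` is finite and
`ζ = 1 / z` if `a = ∞`. The function `g_B(z, a) + log |ζ|` is harmonic near `a` when `B` has a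
Green function (and is `⊤` otherwise), so the limit exists and the upper limit is its value. -/
def innerRadius (B : Set Sphere) (a : Sphere) : ℝ≥0∞ :=
  EReal.exp (limsup (fun ζ : ℂ => greenFunction B a (localParam a ζ) + (Real.log ‖ζ‖ : ℝ))
    (𝓝[≠] (0 : ℂ)))

/-- The product of countably many copies of the Riemann sphere. -/
abbrev SphereInf : Type := ℕ → Sphere

/-- A polycylindrical domain: a product of countably many coordinate domains of the sphere. -/
structure PolycylindricalDomain where
  coord : ℕ → Set Sphere
  isOpen_coord : ∀ k, IsOpen (coord k)
  isConnected_coord : ∀ k, IsConnected (coord k)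

/-- The set of points of a polycylindrical domain. -/
def PolycylindricalDomain.carrier (B : PolycylindricalDomain) : Set SphereInf :=
  {Z | ∀ k, Z k ∈ B.coord k}

/-- The generalized inner radius of a polycylindrical domain at a point: the sequence of the inner
radii of the coordinate domains. -/
def generalizedInnerRadius (B : PolycylindricalDomain) (A : SphereInf) : ℕ → ℝ≥0∞ :=
  fun k => innerRadius (B.coord k) (A k)

/-- The class of pairs of polycylindrical domains containing `A₁` and `A₂` respectively, whose
coordinate domains with the same index do not overlap. -/
def nonoverlappingPairs (A₁ A₂ : SphereInf) :
    Set (PolycylindricalDomain × PolycylindricalDomain) :=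
  {p | A₁ ∈ p.1.carrier ∧ A₂ ∈ p.2.carrier ∧ ∀ k, Disjoint (p.1.coord k) (p.2.coord k)}

/-- The point `(0, 0, …)`. -/
def origin : SphereInf := fun _ => ((0 : ℂ) : Sphere)

/-- The point `(∞, ∞, …)`. -/
def infinity : SphereInf := fun _ => OnePoint.infty

/-- The open unit polydisc, as a set of points of the product of spheres. -/
def unitPolydisc : Set SphereInf := {Z | ∀ k, ∃ z : ℂ, ‖z‖ < 1 ∧ Z k = (z : Sphere)}

/-- The map `Z ↦ 1 / Z`, coordinatewise. -/
def coordInv (Z : SphereInf) : SphereInf := fun k => sphereInv (Z k)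

end PolyCyl

end

/-!
The assertion is coordinatewise, so the matter is the inequality `r(B₁, 0) r(B₂, ∞) ≤ 1` for two
disjoint domains of the sphere. Let `v₁`, `v₂` be elements of the two Perron families and put
`W = v₁ - v₂`. If everything were smooth, `W Δ W ≥ 0`, because `v₁` and `v₂` are nonnegative and
subharmonic with disjoint supports; hence `Δ (W²) ≥ 2 |∇ W|²`. For the means `I` of `W` and `J` of
`W²` over the circle `|z| = e ^ t` this gives `J'' ≥ 2 I' ^ 2 ≥ -4 I' - 2`. At the two ends
`I = -t + a₁` and `I = -t - a₂`, up to small errors, where `a₁`, `a₂` are the means of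
`v₁ + log |z|` and `v₂ - log |z|` near the poles, and `J = I² + O(1)`. Testing the inequality
against the tent function of base `[-N, N]`, all terms of order `N` cancel except those with
`a₁ + a₂`, and what remains is `N (a₁ + a₂) ≤ O(1)` (`mul_radialMean_add_le`).

No smoothness is needed. The Laplacian is replaced by the average over the circle
`z (1 + r e^{iθ})` with one small fixed `r`, which depends on the supports. This average commutes
with rotations and dilations, so it acts on radial means as a random shift of `t` by
`log |1 + r e^{iθ}|`, which has mean zero (`radialMean_sq_le`, `two_mul_le_of_shift_inequality`).

The constant in `O(1)` depends only on an a priori bound for `v + log |ζ|`, where `ζ` is the local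
parameter at the pole. The upper bound is the maximum principle in a punctured disc
(`le_zero_of_submean_punctured_ball`). The lower bound is obtained by replacing `v` by its maximum
with the Green function of a fixed disc around the pole. This uniformity allows `v` to vary with
`N`: a value of `v + log |ζ|` at a point very close to the pole controls the radial mean at a fixed
radius by Harnack's inequality, applied to a harmonic majorant with nearly the same mean
(`PuncturedMinorant.harnack`). The majorant is the real part of a polynomial, found by approximating
the boundary values from above by continuous functions and these by trigonometric polynomials. So
the upper limits that define the inner radii are reached without changing the minorants near
their poles (`add_nonpos_of_minorants`).

Positivity, and the value for the unit polydisc, follow from the explicit Green functions of discs,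
which belong to the Perron families; finiteness follows from the inequality, since the other inner
radius is positive.
-/

namespace PolyCyl

open Filter Topology Metric Set Real MeasureTheory
open scoped ENNReal

/-! ### Logarithmic means and the maximum principle in a punctured disc -/

lemma harmonicOnNhd_log_norm {s : Set ℂ} (hs : (0 : ℂ) ∉ s) :
    InnerProductSpace.HarmonicOnNhd (fun z : ℂ => Real.log ‖z‖) s := by
  intro z hz
  exact analyticAt_id.harmonicAt_log_norm (fun h => hs (by simpa [id] using h ▸ hz))

lemma circleAverage_log_norm_eq {c : ℂ} {r : ℝ} (hr : 0 < r) (h : r < ‖c‖) :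
    circleAverage (fun z : ℂ => Real.log ‖z‖) c r = Real.log ‖c‖ := by
  apply InnerProductSpace.HarmonicOnNhd.circleAverage_eq
  apply harmonicOnNhd_log_norm
  simpa [abs_of_pos hr] using h

lemma circleIntegrable_log_norm {c : ℂ} {r : ℝ} (hr : 0 < r) (h : r < ‖c‖) :
    CircleIntegrable (fun z : ℂ => Real.log ‖z‖) c r := by
  apply ContinuousOn.circleIntegrable hr.le
  refine (continuous_norm.continuousOn).log ?_
  intro x hx h0
  have : x = 0 := by simpa using h0
  subst this
  simp at hx
  linarith

lemma circleAverage_norm_sq {c : ℂ} {r : ℝ} :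
    circleAverage (fun z : ℂ => ‖z‖ ^ 2) c r = ‖c‖ ^ 2 + r ^ 2 := by
  have h1 : EqOn (fun z : ℂ => ‖z‖ ^ 2)
      (fun z => (2 * (starRingEnd ℂ) c * z - ‖c‖ ^ 2 + r ^ 2 : ℂ).re) (sphere c |r|) := by
    intro z hz
    have hz' : ‖z - c‖ ^ 2 = r ^ 2 := by
      rw [mem_sphere_iff_norm.1 hz, sq_abs]
    have e1 : ‖z - c‖ ^ 2 = (z.re - c.re) ^ 2 + (z.im - c.im) ^ 2 := by
      rw [← Complex.normSq_eq_norm_sq, Complex.normSq_apply]; simp; ring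
    have e2 : ‖z‖ ^ 2 = z.re ^ 2 + z.im ^ 2 := by
      rw [← Complex.normSq_eq_norm_sq, Complex.normSq_apply]; ring
    have e3 : ‖c‖ ^ 2 = c.re ^ 2 + c.im ^ 2 := by
      rw [← Complex.normSq_eq_norm_sq, Complex.normSq_apply]; ring
    have e4 : (2 * (starRingEnd ℂ) c * z - ‖c‖ ^ 2 + r ^ 2 : ℂ).re
        = 2 * (c.re * z.re + c.im * z.im) - ‖c‖ ^ 2 + r ^ 2 := by
      rw [← Complex.ofReal_pow, ← Complex.ofReal_pow, Complex.add_re, Complex.sub_re,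
        Complex.ofReal_re, Complex.ofReal_re]
      simp [Complex.mul_re]; ring
    simp only [e4]
    nlinarith
  rw [circleAverage_congr_sphere h1, InnerProductSpace.HarmonicOnNhd.circleAverage_eq]
  · have e3 : ‖c‖ ^ 2 = c.re ^ 2 + c.im ^ 2 := by
      rw [← Complex.normSq_eq_norm_sq, Complex.normSq_apply]; ring
    rw [← Complex.ofReal_pow, ← Complex.ofReal_pow, Complex.add_re, Complex.sub_re,
        Complex.ofReal_re, Complex.ofReal_re]
    simp [Complex.mul_re]; nlinarith
  · intro z _
    refine AnalyticAt.harmonicAt_re (f := fun z : ℂ => 2 * (starRingEnd ℂ) c * z - ‖c‖ ^ 2 + r ^ 2) ?_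
    fun_prop

/-- The maximum principle in a punctured disc, for functions bounded above near the puncture. -/
theorem le_zero_of_submean_punctured_ball {u : ℂ → ℝ} {R : ℝ} (hR : 0 < R)
    (husc : UpperSemicontinuousOn u (closedBall 0 R \ {0}))
    (hsub : ∀ z ∈ ball (0 : ℂ) R \ {0}, ∃ δ > 0, ∀ r, 0 < r → r ≤ δ →
      CircleIntegrable u z r ∧ u z ≤ circleAverage u z r)
    (hb : ∃ M, ∀ᶠ z in 𝓝[≠] (0 : ℂ), u z ≤ M)
    (hs : ∀ z, ‖z‖ = R → u z ≤ 0) :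
    ∀ z, z ≠ 0 → ‖z‖ ≤ R → u z ≤ 0 := by
  intro z₀ hz₀ hz₀R
  by_contra! hpos
  have hn₀ : 0 < ‖z₀‖ := norm_pos_iff.2 hz₀
  obtain ⟨M, hM⟩ := hb
  -- The perturbation is strictly subharmonic, nonpositive on the outer circle, and tends to
  -- `-∞` at the puncture.
  set q : ℂ → ℝ := fun z => Real.log ‖z‖ - Real.log R + (‖z‖ ^ 2 - R ^ 2) with hq
  have hqle : ∀ z, z ≠ 0 → ‖z‖ ≤ R → q z ≤ 0 := by
    intro z hz hzR
    have h1 := Real.log_le_log (norm_pos_iff.2 hz) hzR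
    have h2 := pow_le_pow_left₀ (norm_nonneg z) hzR 2
    simp only [hq]; linarith
  obtain ⟨ε, hε, hε₀⟩ : ∃ ε > 0, 0 < u z₀ + ε * q z₀ := by
    refine ⟨u z₀ / (2 * (|q z₀| + 1)), by positivity, ?_⟩
    have h1 : u z₀ / (2 * (|q z₀| + 1)) * |q z₀| < u z₀ := by
      rw [div_mul_eq_mul_div, div_lt_iff₀ (by positivity)]
      nlinarith [abs_nonneg (q z₀)]
    have h2 : -(u z₀ / (2 * (|q z₀| + 1)) * |q z₀|) ≤ u z₀ / (2 * (|q z₀| + 1)) * q z₀ := by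
      rw [← mul_neg]
      exact mul_le_mul_of_nonneg_left (neg_abs_le _) (by positivity)
    linarith
  set w : ℂ → ℝ := fun z => u z + ε * q z with hw
  have hcontq : ContinuousOn q {0}ᶜ := by
    refine ((continuous_norm.continuousOn.log ?_).sub continuousOn_const).add (by fun_prop)
    intro x hx h; exact hx (by simpa using h)
  obtain ⟨η, hη, hηle⟩ : ∃ η > 0, ∀ z, z ≠ 0 → ‖z‖ < η → ‖z‖ ≤ R → w z ≤ 0 := by
    rw [eventually_nhdsWithin_iff, Metric.eventually_nhds_iff] at hM
    obtain ⟨η₁, hη₁, hM⟩ := hM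
    refine ⟨min η₁ (R * Real.exp (-(|M| / ε))), by positivity, ?_⟩
    intro z hz hzη hzR
    have h1 : u z ≤ M := hM (by simpa using hzη.trans_le (min_le_left _ _)) hz
    have h2 : Real.log ‖z‖ ≤ Real.log R - |M| / ε := by
      have := Real.log_le_log (norm_pos_iff.2 hz) (hzη.le.trans (min_le_right _ _))
      rw [Real.log_mul hR.ne' (Real.exp_pos _).ne', Real.log_exp] at this
      linarith
    have h3 := pow_le_pow_left₀ (norm_nonneg z) hzR 2
    have h4 : q z ≤ - (|M| / ε) := by simp only [hq]; linarith
    have h5 : ε * q z ≤ -|M| := by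
      calc ε * q z ≤ ε * (-(|M| / ε)) := mul_le_mul_of_nonneg_left h4 hε.le
        _ = -|M| := by field_simp
    have := le_abs_self M
    simp only [hw]; linarith
  have hz₀η : η ≤ ‖z₀‖ := by
    by_contra! h
    exact absurd (hηle z₀ hz₀ h hz₀R) (not_le.2 hε₀)
  set A : Set ℂ := closedBall 0 R ∩ {z | η ≤ ‖z‖} with hA
  have hAc : IsCompact A :=
    (isCompact_closedBall _ _).inter_right (isClosed_le continuous_const continuous_norm)
  have hA0 : ∀ z ∈ A, z ≠ 0 := by
    rintro z hz rfl
    have := hz.2; simp at this; linarith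
  have hwusc : UpperSemicontinuousOn w A := by
    have h1 : UpperSemicontinuousOn (fun z => ε * q z) A := by
      apply ContinuousOn.upperSemicontinuousOn
      exact (hcontq.mono fun z hz => hA0 z hz).const_smul ε
    exact (husc.mono fun z hz => ⟨hz.1, hA0 z hz⟩).add h1
  have hz₀A : z₀ ∈ A := ⟨by simpa using hz₀R, hz₀η⟩
  obtain ⟨z₁, hz₁A, hmax⟩ := hwusc.exists_isMaxOn ⟨z₀, hz₀A⟩ hAc
  have hmax' : ∀ z, z ≠ 0 → ‖z‖ ≤ R → w z ≤ w z₁ := by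
    intro z hz hzR
    by_cases h : η ≤ ‖z‖
    · exact hmax (show z ∈ A from ⟨by simpa using hzR, h⟩)
    · exact (hηle z hz (not_le.1 h) hzR).trans (hε₀.le.trans (hmax hz₀A))
  have hpos₁ : 0 < w z₁ := hε₀.trans_le (hmax hz₀A)
  have hz₁0 := hA0 z₁ hz₁A
  have hz₁R : ‖z₁‖ ≤ R := by simpa using hz₁A.1
  have hz₁lt : ‖z₁‖ < R := by
    refine lt_of_le_of_ne hz₁R fun h => ?_
    have h1 := hs z₁ h
    have h2 := mul_nonpos_of_nonneg_of_nonpos hε.le (hqle z₁ hz₁0 hz₁R)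
    simp only [hw] at hpos₁; linarith
  obtain ⟨δ, hδ, hδs⟩ := hsub z₁ ⟨by simpa using hz₁lt, hz₁0⟩
  set r := min δ (min (‖z₁‖ / 2) (R - ‖z₁‖)) with hr
  have hn₁ : 0 < ‖z₁‖ := norm_pos_iff.2 hz₁0
  have hr0 : 0 < r := by
    have : 0 < R - ‖z₁‖ := by linarith
    positivity
  have hr1 : r < ‖z₁‖ := by
    have := (min_le_right δ _).trans (min_le_left (‖z₁‖ / 2) (R - ‖z₁‖))
    rw [← hr] at this; linarith
  have hr2 : r ≤ R - ‖z₁‖ := (min_le_right δ _).trans (min_le_right (‖z₁‖ / 2) (R - ‖z₁‖))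
  obtain ⟨hint, hle⟩ := hδs r hr0 (min_le_left _ _)
  have hlogint := circleIntegrable_log_norm hr0 hr1
  have hsqint : CircleIntegrable (fun z : ℂ => ‖z‖ ^ 2) z₁ r :=
    (by fun_prop : Continuous fun z : ℂ => ‖z‖ ^ 2).continuousOn.circleIntegrable hr0.le
  have hsqcint : CircleIntegrable (fun z : ℂ => ‖z‖ ^ 2 + (-Real.log R - R ^ 2)) z₁ r :=
    hsqint.add (circleIntegrable_const _ z₁ r)
  have hqeq : q = fun z : ℂ => Real.log ‖z‖ + (‖z‖ ^ 2 + (-Real.log R - R ^ 2)) := by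
    funext z; simp only [hq]; ring
  have hqint : CircleIntegrable q z₁ r := by
    rw [hqeq]; exact hlogint.add hsqcint
  have hqavg : circleAverage q z₁ r = q z₁ + r ^ 2 := by
    rw [hqeq, circleAverage_fun_add hlogint hsqcint, circleAverage_fun_add hsqint (circleIntegrable_const _ z₁ r), circleAverage_const,
      circleAverage_log_norm_eq hr0 hr1, circleAverage_norm_sq]
    ring
  have hεq : CircleIntegrable (fun z => ε * q z) z₁ r := hqint.const_smul (a := ε)
  have hwint : CircleIntegrable w z₁ r := hint.add hεq
  have hwavg : circleAverage w z₁ r = circleAverage u z₁ r + ε * (q z₁ + r ^ 2) := by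
    have : circleAverage (fun z => ε * q z) z₁ r = ε * (q z₁ + r ^ 2) := by
      rw [← hqavg]; exact circleAverage_fun_smul (a := ε)
    rw [hw, circleAverage_fun_add hint hεq]
    exact congrArg _ this
  have hup : circleAverage w z₁ r ≤ w z₁ := by
    apply circleAverage_mono_on_of_le_circle hwint
    intro z hz
    rw [abs_of_pos hr0, mem_sphere_iff_norm] at hz
    apply hmax'
    · rintro rfl; simp at hz; linarith
    · have := norm_le_norm_add_norm_sub' z z₁
      linarith
  rw [hwavg] at hup
  have : 0 < ε * r ^ 2 := by positivity
  simp only [hw] at hup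
  nlinarith

/-! ### Harmonic majorants of upper semicontinuous functions on a circle -/

/-- The Lipschitz majorant `x ↦ sup_y (g y - n d(x, y))`, the supremum being over `y ∈ S`. -/
noncomputable def lipMajorant (g : ℂ → ℝ) (S : Set ℂ) (n : ℕ) (x : ℂ) : ℝ :=
  ⨆ y : S, (g y - n * dist x y)

lemma bddAbove_lipMajorant {g : ℂ → ℝ} {S : Set ℂ} {C : ℝ} (hC : ∀ y ∈ S, g y ≤ C) (n : ℕ) (x : ℂ) :
    BddAbove (range fun y : S => g y - n * dist x y) := by
  refine ⟨C, ?_⟩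
  rintro _ ⟨y, rfl⟩
  have := hC y y.2
  have : (0 : ℝ) ≤ n * dist x y := by positivity
  simp only; linarith

lemma le_lipMajorant {g : ℂ → ℝ} {S : Set ℂ} {C : ℝ} (hC : ∀ y ∈ S, g y ≤ C) (n : ℕ) {x : ℂ}
    (hx : x ∈ S) : g x ≤ lipMajorant g S n x := by
  have := le_ciSup (bddAbove_lipMajorant hC n x) ⟨x, hx⟩
  simpa [lipMajorant] using this

lemma lipMajorant_le {g : ℂ → ℝ} {S : Set ℂ} {C : ℝ} (hS : S.Nonempty) (hC : ∀ y ∈ S, g y ≤ C)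
    (n : ℕ) (x : ℂ) : lipMajorant g S n x ≤ C := by
  have := hS.to_subtype
  refine ciSup_le fun y => ?_
  have := hC y y.2
  have : (0 : ℝ) ≤ n * dist x y := by positivity
  linarith

lemma lipschitzWith_lipMajorant {g : ℂ → ℝ} {S : Set ℂ} {C : ℝ} (hS : S.Nonempty)
    (hC : ∀ y ∈ S, g y ≤ C) (n : ℕ) : LipschitzWith n (lipMajorant g S n) := by
  have := hS.to_subtype
  refine LipschitzWith.of_le_add_mul _ fun x x' => ?_
  refine ciSup_le fun y => ?_
  have h1 := le_ciSup (bddAbove_lipMajorant hC n x') y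
  have h2 := dist_triangle x' x y
  rw [dist_comm x' x] at h2
  have h3 : (n : ℝ) * dist x' y ≤ n * (dist x x' + dist x y) := by gcongr
  change g y - n * dist x' y ≤ lipMajorant g S n x' at h1
  push_cast
  linarith

lemma tendsto_lipMajorant {g : ℂ → ℝ} {S : Set ℂ} {m C : ℝ} (hg : UpperSemicontinuousOn g S)
    (hm : ∀ y ∈ S, m ≤ g y) (hC : ∀ y ∈ S, g y ≤ C) {x : ℂ} (hx : x ∈ S) :
    Tendsto (fun n => lipMajorant g S n x) atTop (𝓝 (g x)) := by
  have hne : Nonempty S := ⟨⟨x, hx⟩⟩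
  rw [Metric.tendsto_atTop]
  intro ε hε
  have h1 := hg x hx (g x + ε / 2) (by linarith)
  rw [eventually_nhdsWithin_iff, Metric.eventually_nhds_iff] at h1
  obtain ⟨δ, hδ, h1⟩ := h1
  obtain ⟨N, hN⟩ := exists_nat_ge ((C - m) / δ)
  refine ⟨N, fun n hn => ?_⟩
  have hge := le_lipMajorant hC n hx
  have hle : lipMajorant g S n x ≤ g x + ε / 2 := by
    refine ciSup_le fun y => ?_
    by_cases hy : dist (y : ℂ) x < δ
    · have := h1 hy y.2
      have : (0 : ℝ) ≤ n * dist x y := by positivity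
      linarith
    · have h2 : (C - m) ≤ n * dist x y := by
        have h3 : (C - m) / δ ≤ n := hN.trans (by exact_mod_cast hn)
        rw [div_le_iff₀ hδ] at h3
        refine h3.trans ?_
        rw [dist_comm]
        gcongr
        exact not_lt.1 hy
      have := hC y y.2
      have := hm x hx
      linarith
  rw [Real.dist_eq, abs_of_nonneg (by linarith)]
  linarith

/-- A bounded upper semicontinuous function on a circle has continuous majorants, with the same
upper bound, whose circle averages are arbitrarily close to its own. -/
lemma exists_continuous_majorant {g : ℂ → ℝ} {R m C : ℝ} (hR : 0 < R)
    (hg : UpperSemicontinuousOn g (sphere 0 R))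
    (hm : ∀ y ∈ sphere (0 : ℂ) R, m ≤ g y) (hC : ∀ y ∈ sphere (0 : ℂ) R, g y ≤ C) {ε : ℝ} (hε : 0 < ε) :
    ∃ φ : ℂ → ℝ, Continuous φ ∧ (∀ z, ‖z‖ = R → g z ≤ φ z ∧ φ z ≤ C) ∧
      circleAverage φ 0 R ≤ circleAverage g 0 R + ε := by
  have hS : (sphere (0 : ℂ) R).Nonempty := NormedSpace.sphere_nonempty.2 hR.le
  have hcont := fun n => (lipschitzWith_lipMajorant hS hC n).continuous
  have hlim : Tendsto (fun n : ℕ => circleAverage (lipMajorant g (sphere 0 R) n) 0 R) atTop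
      (𝓝 (circleAverage g 0 R)) := by
    unfold circleAverage
    refine Tendsto.const_smul ?_ _
    refine intervalIntegral.tendsto_integral_filter_of_dominated_convergence
      (fun _ => |m| + |C|) ?_ ?_ ?_ ?_
    · exact Eventually.of_forall fun n =>
        ((hcont n).comp (continuous_circleMap 0 R)).aestronglyMeasurable
    · refine Eventually.of_forall fun n => Eventually.of_forall fun θ _ => ?_
      have hmem := circleMap_mem_sphere (0 : ℂ) hR.le θ
      have h1 := (hm _ hmem).trans (le_lipMajorant hC n hmem)
      have h2 := lipMajorant_le hS hC n (circleMap 0 R θ)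
      rw [Real.norm_eq_abs, abs_le]
      have := neg_abs_le m
      have := le_abs_self C
      have := abs_nonneg m
      have := abs_nonneg C
      constructor <;> linarith
    · exact intervalIntegrable_const
    · exact Eventually.of_forall fun θ _ =>
        tendsto_lipMajorant hg hm hC (circleMap_mem_sphere (0 : ℂ) hR.le θ)
  obtain ⟨n, hn⟩ := (hlim.eventually (gt_mem_nhds (lt_add_of_pos_right _ hε))).exists
  refine ⟨_, hcont n, fun z hz => ?_, hn.le⟩
  exact ⟨le_lipMajorant hC n (by simpa using hz), lipMajorant_le hS hC n z⟩

/-- Continuous functions on a circle centred at the origin are uniform limits of real parts of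
polynomials (density of the trigonometric polynomials). -/
lemma exists_polynomial_re_approx {φ : ℂ → ℝ} (hφ : Continuous φ) {R : ℝ} (hR : 0 < R)
    {ε : ℝ} (hε : 0 < ε) :
    ∃ Q : Polynomial ℂ, ∀ z : ℂ, ‖z‖ = R → |φ z - (Q.eval z).re| < ε := by
  have : Fact (0 < 2 * π) := ⟨by positivity⟩
  have hRC : (R : ℂ) ≠ 0 := by exact_mod_cast hR.ne'
  have key : ∀ p ∈ Submodule.span ℂ (range <| @fourier (2 * π)), ∃ Q₁ Q₂ : Polynomial ℂ,
      ∀ x : AddCircle (2 * π), p x = Q₁.eval (R * (AddCircle.toCircle x : ℂ)) +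
        (starRingEnd ℂ) (Q₂.eval (R * (AddCircle.toCircle x : ℂ))) := by
    intro p hp
    induction hp using Submodule.span_induction with
    | mem p hp =>
      obtain ⟨n, rfl⟩ := hp
      obtain ⟨k, rfl | rfl⟩ := n.eq_nat_or_neg
      · refine ⟨Polynomial.C ((R : ℂ) ^ k)⁻¹ * Polynomial.X ^ k, 0, fun x => ?_⟩
        simp [fourier_apply, AddCircle.toCircle_nsmul, mul_pow, hRC]
      · refine ⟨0, Polynomial.C ((R : ℂ) ^ k)⁻¹ * Polynomial.X ^ k, fun x => ?_⟩
        rw [fourier_neg]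
        simp [fourier_apply, AddCircle.toCircle_nsmul, mul_pow, hRC]
    | zero => exact ⟨0, 0, by simp⟩
    | add p q _ _ hp hq =>
      obtain ⟨P₁, P₂, hP⟩ := hp
      obtain ⟨Q₁, Q₂, hQ⟩ := hq
      refine ⟨P₁ + Q₁, P₂ + Q₂, fun x => ?_⟩
      simp [hP, hQ]; ring
    | smul a p _ hp =>
      obtain ⟨P₁, P₂, hP⟩ := hp
      refine ⟨Polynomial.C a * P₁, Polynomial.C ((starRingEnd ℂ) a) * P₂, fun x => ?_⟩
      simp [hP, mul_add]
  let F : C(AddCircle (2 * π), ℂ) :=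
    ⟨fun x => (φ (R * (AddCircle.toCircle x : ℂ)) : ℂ), by
      have := AddCircle.continuous_toCircle (T := 2 * π)
      fun_prop⟩
  have hF : F ∈ (Submodule.span ℂ (range <| @fourier (2 * π))).topologicalClosure := by
    rw [span_fourier_closure_eq_top]; trivial
  obtain ⟨p, hp, hpF⟩ := Metric.mem_closure_iff.1 hF ε hε
  obtain ⟨Q₁, Q₂, hQ⟩ := key p hp
  refine ⟨Q₁ + Q₂, fun z hz => ?_⟩
  obtain ⟨x, hx⟩ : ∃ x : AddCircle (2 * π), (R : ℂ) * (AddCircle.toCircle x : ℂ) = z := by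
    have hz1 : ‖z / R‖ = 1 := by
      rw [norm_div, hz, Complex.norm_real, Real.norm_of_nonneg hR.le, div_self hR.ne']
    obtain ⟨x, hx⟩ := (AddCircle.homeomorphCircle (T := 2 * π) (by positivity)).surjective
      ⟨z / R, mem_sphere_zero_iff_norm.2 hz1⟩
    refine ⟨x, ?_⟩
    have hx' := congrArg (Subtype.val) hx
    rw [AddCircle.homeomorphCircle_apply] at hx'
    rw [hx']
    field_simp
  have h1 : ‖F x - p x‖ < ε := by
    rw [← dist_eq_norm]
    exact (ContinuousMap.dist_apply_le_dist x).trans_lt hpF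
  have h2 : (F x - p x).re = φ z - ((Q₁ + Q₂).eval z).re := by
    rw [hQ, hx]
    simp [F, hx]
  rw [← h2]
  exact (Complex.abs_re_le_norm _).trans_lt h1

lemma harmonicOnNhd_re_eval (Q : Polynomial ℂ) (s : Set ℂ) :
    InnerProductSpace.HarmonicOnNhd (fun z : ℂ => (Q.eval z).re) s := fun z _ =>
  AnalyticAt.harmonicAt_re (f := fun z => Q.eval z)
    ((Polynomial.differentiable Q).analyticAt z)

lemma circleAverage_re_eval (Q : Polynomial ℂ) (c : ℂ) (r : ℝ) :
    circleAverage (fun z : ℂ => (Q.eval z).re) c r = (Q.eval c).re :=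
  InnerProductSpace.HarmonicOnNhd.circleAverage_eq (harmonicOnNhd_re_eval Q _)

lemma continuous_re_eval (Q : Polynomial ℂ) : Continuous (fun z : ℂ => (Q.eval z).re) :=
  Complex.continuous_re.comp Q.continuous

/-! ### Minorants with a logarithmic pole in the plane: monotone means and Harnack's inequality -/

/-- The trace in the plane of an element of the Perron family with pole `0`: a nonnegative function
vanishing outside the compact set `K`, with at most a logarithmic pole at `0`, upper
semicontinuous away from `0`, and dominated by its means over all circles centred at `z ≠ 0` whose
radius is small compared with `‖z‖`. The value at `0` is irrelevant. -/
structure PuncturedMinorant (f : ℂ → ℝ) (K : Set ℂ) : Prop where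
  nonneg : ∀ z, 0 ≤ f z
  usc : UpperSemicontinuousOn f {0}ᶜ
  isCompact : IsCompact K
  eq_zero : ∀ z, z ∉ K → f z = 0
  submean : ∃ δ > 0, δ < 1 ∧ ∀ z ≠ 0, ∀ r, 0 < r → r ≤ δ → f z ≤ circleAverage f z (r * ‖z‖)
  log_pole : ∃ M : ℝ, ∀ᶠ z in 𝓝[≠] (0 : ℂ), f z + Real.log ‖z‖ ≤ M

lemma measurable_of_upperSemicontinuousOn_compl {f : ℂ → ℝ}
    (hf : UpperSemicontinuousOn f {0}ᶜ) : Measurable f := by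
  refine measurable_of_Iio fun a => ?_
  obtain ⟨u, hu, hua⟩ := (upperSemicontinuousOn_iff_preimage_Iio.1 hf) a
  have : f ⁻¹' Iio a = ({0}ᶜ ∩ u) ∪ (f ⁻¹' Iio a ∩ {0}) := by
    rw [← hua]
    ext z
    by_cases hz : z = 0 <;> simp [hz]
  rw [this]
  refine ((measurableSet_singleton 0).compl.inter hu.measurableSet).union ?_
  exact ((finite_singleton (0 : ℂ)).subset inter_subset_right).measurableSet

lemma circleIntegrable_of_bounded {f : ℂ → ℝ} {c : ℂ} {r C : ℝ} (hf : Measurable f)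
    (hC : ∀ z ∈ sphere c |r|, |f z| ≤ C) : CircleIntegrable f c r := by
  refine (intervalIntegrable_const (c := C)).mono_fun ?_ ?_
  · exact (hf.comp (continuous_circleMap c r).measurable).aestronglyMeasurable
  · refine Eventually.of_forall fun θ => ?_
    have := hC _ (circleMap_mem_sphere' c r θ)
    exact this.trans (le_abs_self C)

lemma eventually_le_add_const_of_continuousAt {h : ℂ → ℝ} (hh : Continuous h) (s : Set ℂ) :
    ∀ᶠ z in 𝓝[s] (0 : ℂ), h z ≤ h 0 + 1 := by
  refine (hh.continuousAt.mono_left nhdsWithin_le_nhds : Tendsto h (𝓝[s] 0) (𝓝 (h 0))).eventually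
    (eventually_le_nhds ?_)
  linarith

namespace PuncturedMinorant

variable {f : ℂ → ℝ} {K : Set ℂ}

lemma measurable (hf : PuncturedMinorant f K) : Measurable f :=
  measurable_of_upperSemicontinuousOn_compl hf.usc

lemma circleIntegrable (hf : PuncturedMinorant f K) {c : ℂ} {r : ℝ} (h : |r| ≠ ‖c‖) :
    CircleIntegrable f c r := by
  have h0 : sphere c |r| ⊆ {0}ᶜ := by
    rintro z hz rfl
    simp at hz
    exact h hz.symm
  obtain ⟨C, hC⟩ := (hf.usc.mono h0).bddAbove_of_isCompact (isCompact_sphere c |r|)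
  refine circleIntegrable_of_bounded (C := C) hf.measurable fun z hz => ?_
  rw [abs_of_nonneg (hf.nonneg z)]
  exact hC (mem_image_of_mem f hz)

/-- Comparison with a harmonic function: if `f + log ‖z‖` is at most the harmonic function `h` on a
circle around the puncture, then also inside. -/
lemma add_log_le_of_sphere (hf : PuncturedMinorant f K) {R : ℝ} (hR : 0 < R) (Q : Polynomial ℂ)
    (hQ : ∀ z, ‖z‖ = R → f z + Real.log R ≤ (Q.eval z).re) :
    ∀ z, z ≠ 0 → ‖z‖ ≤ R → f z + Real.log ‖z‖ ≤ (Q.eval z).re := by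
  have hlogc : ContinuousOn (fun z : ℂ => Real.log ‖z‖) {0}ᶜ := by
    refine continuous_norm.continuousOn.log ?_
    intro x hx h; exact hx (by simpa using h)
  set u : ℂ → ℝ := fun z => f z + (Real.log ‖z‖ - (Q.eval z).re) with hu
  suffices ∀ z, z ≠ 0 → ‖z‖ ≤ R → u z ≤ 0 by
    intro z hz hzR
    have := this z hz hzR
    simp only [hu] at this; linarith
  refine le_zero_of_submean_punctured_ball hR ?_ ?_ ?_ ?_
  · have h1 : ContinuousOn (fun z : ℂ => Real.log ‖z‖ - (Q.eval z).re) {0}ᶜ :=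
      hlogc.sub (continuous_re_eval Q).continuousOn
    exact (hf.usc.add h1.upperSemicontinuousOn).mono fun z hz => hz.2
  · rintro z ⟨-, hz⟩
    have hz : z ≠ 0 := hz
    have hn := norm_pos_iff.2 hz
    obtain ⟨δ, hδ, hδ1, hsub⟩ := hf.submean
    refine ⟨δ * ‖z‖, by positivity, fun r hr hrδ => ?_⟩
    have hrz : r < ‖z‖ := by nlinarith
    have i1 : CircleIntegrable f z r := hf.circleIntegrable (by rw [abs_of_pos hr]; exact hrz.ne)
    have i2 := circleIntegrable_log_norm hr hrz
    have i3 : CircleIntegrable (fun z : ℂ => (Q.eval z).re) z r :=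
      (continuous_re_eval Q).continuousOn.circleIntegrable hr.le
    have i23 : CircleIntegrable (fun z : ℂ => Real.log ‖z‖ - (Q.eval z).re) z r := i2.sub i3
    refine ⟨i1.add i23, ?_⟩
    rw [hu, circleAverage_fun_add i1 i23, circleAverage_fun_sub i2 i3,
      circleAverage_log_norm_eq hr hrz, circleAverage_re_eval]
    have := hsub z hz (r / ‖z‖) (by positivity) (by rw [div_le_iff₀ hn]; exact hrδ)
    rw [div_mul_cancel₀ _ hn.ne'] at this
    linarith
  · obtain ⟨M, hM⟩ := hf.log_pole
    refine ⟨M + (-(Q.eval 0).re + 1), ?_⟩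
    filter_upwards [hM, eventually_le_add_const_of_continuousAt (continuous_re_eval Q).neg _]
      with z h1 h2
    simp only [Pi.neg_apply] at h2
    simp only [hu]; linarith
  · intro z hz
    have := hQ z hz
    simp only [hu, hz]; linarith

lemma add_log_le (hf : PuncturedMinorant f K) {R : ℝ} (hR : 0 < R) (hK : K ⊆ ball 0 R)
    {z : ℂ} (hz : z ≠ 0) (hzR : ‖z‖ ≤ R) : f z + Real.log ‖z‖ ≤ Real.log R := by
  have := hf.add_log_le_of_sphere hR (Polynomial.C (Real.log R : ℂ)) (fun w hw => ?_) z hz hzR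
  · simpa only [Polynomial.eval_C, Complex.ofReal_re] using this
  · rw [hf.eq_zero w fun h => by simpa [hw] using hK h]
    simp

/-- On a disc around the puncture, `f + log ‖z‖` has a harmonic majorant whose
value at the centre is as close as desired to the mean of `f + log ‖z‖` over the boundary. -/
lemma exists_harmonic_majorant (hf : PuncturedMinorant f K) {R C : ℝ} (hR : 0 < R)
    (hC : ∀ z, ‖z‖ = R → f z + Real.log R ≤ C) {ε : ℝ} (hε : 0 < ε) :
    ∃ Q : Polynomial ℂ, (∀ z, z ≠ 0 → ‖z‖ ≤ R → f z + Real.log ‖z‖ ≤ (Q.eval z).re) ∧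
      (∀ z, ‖z‖ = R → (Q.eval z).re ≤ C + ε) ∧
      (Q.eval 0).re ≤ circleAverage f 0 R + Real.log R + ε := by
  obtain ⟨φ, hφ, hφ1, hφ2⟩ := exists_continuous_majorant (g := f) (m := 0) (C := C - Real.log R) hR
    (hf.usc.mono fun z hz => by rintro rfl; simp at hz; exact hR.ne' hz.symm)
    (fun z _ => hf.nonneg z) (fun z hz => by have := hC z (by simpa using hz); linarith)
    (show 0 < ε / 3 by positivity)
  obtain ⟨Q₀, hQ₀⟩ := exists_polynomial_re_approx hφ hR (show 0 < ε / 3 by positivity)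
  have hev : ∀ z : ℂ, ((Q₀ + Polynomial.C ((Real.log R + ε / 3 : ℝ) : ℂ)).eval z).re =
      (Q₀.eval z).re + (Real.log R + ε / 3) := by
    intro z
    rw [Polynomial.eval_add, Polynomial.eval_C, Complex.add_re, Complex.ofReal_re]
  refine ⟨Q₀ + Polynomial.C ((Real.log R + ε / 3 : ℝ) : ℂ), ?_, ?_, ?_⟩
  · refine hf.add_log_le_of_sphere hR _ fun z hz => ?_
    rw [hev]
    have h1 := (abs_lt.1 (hQ₀ z hz)).2
    have h2 := (hφ1 z hz).1
    linarith
  · intro z hz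
    rw [hev]
    have h1 := (abs_lt.1 (hQ₀ z hz)).1
    have h2 := (hφ1 z hz).2
    linarith
  · have iφ : CircleIntegrable φ 0 R := hφ.continuousOn.circleIntegrable hR.le
    have h1 : circleAverage (fun z => (Q₀.eval z).re) 0 R ≤
        circleAverage (fun z => φ z + ε / 3) 0 R := by
      refine circleAverage_mono ((continuous_re_eval Q₀).continuousOn.circleIntegrable hR.le)
        (iφ.add (circleIntegrable_const _ _ _)) fun z hz => ?_
      have := (abs_lt.1 (hQ₀ z (by simpa [abs_of_pos hR] using hz))).1
      linarith
    rw [circleAverage_re_eval, circleAverage_fun_add iφ (circleIntegrable_const _ _ _),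
      circleAverage_const] at h1
    rw [hev]
    linarith

/-- A common upper bound of `f + log ‖z‖` on a circle around the puncture. -/
lemma exists_sphere_bound (hf : PuncturedMinorant f K) {R : ℝ} (hR : 0 < R) :
    ∃ C, ∀ z, ‖z‖ = R → f z + Real.log R ≤ C := by
  obtain ⟨C, hC⟩ := (hf.usc.mono (s := {0}ᶜ) (t := sphere 0 R)
    fun z hz => by rintro rfl; simp at hz; exact hR.ne' hz.symm).bddAbove_of_isCompact
      (isCompact_sphere 0 R)
  refine ⟨C + Real.log R, fun z hz => ?_⟩
  have := hC (mem_image_of_mem f (show z ∈ sphere (0 : ℂ) R by simpa using hz))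
  linarith

/-- The circular means of the subharmonic function `f + log ‖z‖` increase with the radius. -/
lemma circleAverage_add_log_mono (hf : PuncturedMinorant f K) {r R : ℝ} (hr : 0 < r) (hrR : r ≤ R) :
    circleAverage f 0 r + Real.log r ≤ circleAverage f 0 R + Real.log R := by
  have hR := hr.trans_le hrR
  refine le_of_forall_pos_le_add fun ε hε => ?_
  obtain ⟨C, hC⟩ := hf.exists_sphere_bound hR
  obtain ⟨Q, hQ1, -, hQ2⟩ := hf.exists_harmonic_majorant hR hC hε
  refine le_trans ?_ hQ2
  have i1 : CircleIntegrable f 0 r := hf.circleIntegrable (by simpa using hr.ne')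
  have h1 : circleAverage (fun z => f z + Real.log r) 0 r ≤
      circleAverage (fun z => (Q.eval z).re) 0 r := by
    refine circleAverage_mono (i1.add (circleIntegrable_const _ _ _))
      ((continuous_re_eval Q).continuousOn.circleIntegrable hr.le) fun z hz => ?_
    have hz' : ‖z‖ = r := by simpa [abs_of_pos hr] using hz
    have := hQ1 z (norm_pos_iff.1 (hz' ▸ hr)) (hz' ▸ hrR)
    rwa [hz'] at this
  rwa [circleAverage_fun_add i1 (circleIntegrable_const _ _ _), circleAverage_const,
    circleAverage_re_eval] at h1

/-- Harnack's inequality: a lower bound for `f + log ‖z‖` at one point near the puncture gives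
a lower bound for its circular means about the puncture. -/
lemma harnack (hf : PuncturedMinorant f K) {R C m : ℝ}
    (hC : ∀ z, ‖z‖ = R → f z + Real.log R ≤ C) {ζ : ℂ} (hζ : ζ ≠ 0) (hζR : ‖ζ‖ < R)
    (hm : m ≤ f ζ + Real.log ‖ζ‖) :
    C - (C - m) * ((R + ‖ζ‖) / (R - ‖ζ‖)) ≤ circleAverage f 0 R + Real.log R := by
  have hR : 0 < R := (norm_nonneg ζ).trans_lt hζR
  set k := (R + ‖ζ‖) / (R - ‖ζ‖) with hk
  have hk0 : 0 < k := div_pos (by positivity) (by linarith)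
  suffices ∀ ε > 0, C - (C - m) * k ≤ circleAverage f 0 R + Real.log R + ε by
    exact le_of_forall_pos_le_add this
  intro ε' hε'
  set ε := ε' / k with hεdef
  have hε : 0 < ε := div_pos hε' hk0
  have hεk : ε * k = ε' := div_mul_cancel₀ _ hk0.ne'
  obtain ⟨Q, hQ1, hQ2, hQ3⟩ := hf.exists_harmonic_majorant hR hC hε
  set H : Polynomial ℂ := Polynomial.C ((C + ε : ℝ) : ℂ) - Q with hH
  have hev : ∀ z, (H.eval z).re = C + ε - (Q.eval z).re := by
    intro z
    rw [hH, Polynomial.eval_sub, Polynomial.eval_C, Complex.sub_re, Complex.ofReal_re]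
  have hζb : ζ ∈ ball (0 : ℂ) R := by simpa using hζR
  have hP := (harmonicOnNhd_re_eval H (closedBall 0 R)).circleAverage_re_herglotzRieszKernel_smul hζb
  have hle : (R - ‖ζ‖) / (R + ‖ζ‖) * (H.eval 0).re ≤ (H.eval ζ).re := by
    rw [← hP, ← circleAverage_re_eval H 0 R]
    rw [← smul_eq_mul, ← circleAverage_fun_smul]
    have hsph : sphere (0 : ℂ) |R| = sphere 0 R := by rw [abs_of_pos hR]
    refine circleAverage_mono ?_ ?_ fun z hz => ?_
    · have := continuous_re_eval H
      exact Continuous.continuousOn (by fun_prop) |>.circleIntegrable hR.le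
    · apply ContinuousOn.circleIntegrable'
      refine ContinuousOn.smul ?_ (continuous_re_eval H).continuousOn
      exact Complex.continuous_re.comp_continuousOn (continuousOn_herglotzRieszKernel_sphere hζb)
    · rw [hsph] at hz
      have h1 := le_re_herglotzRieszKernel hz hζb
      have h2 : 0 ≤ (H.eval z).re := by
        rw [hev]
        have := hQ2 z (by simpa using hz)
        linarith
      rw [← herglotzRieszKernel_def, sub_zero] at h1
      exact mul_le_mul_of_nonneg_right h1 h2
  rw [hev, hev] at hle
  have h1 := hQ1 ζ hζ hζR.le
  have h2 : (R - ‖ζ‖) / (R + ‖ζ‖) * (C + ε - (Q.eval 0).re) ≤ C + ε - m := by linarith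
  have h3 : C + ε - (Q.eval 0).re ≤ (C + ε - m) * k := by
    have h4 := mul_le_mul_of_nonneg_right h2 hk0.le
    have h5 : (R - ‖ζ‖) / (R + ‖ζ‖) * k = 1 := by
      have : 0 < R - ‖ζ‖ := by linarith
      rw [hk]; field_simp
    calc C + ε - (Q.eval 0).re
        = (R - ‖ζ‖) / (R + ‖ζ‖) * k * (C + ε - (Q.eval 0).re) := by rw [h5, one_mul]
      _ = (R - ‖ζ‖) / (R + ‖ζ‖) * (C + ε - (Q.eval 0).re) * k := by ring
      _ ≤ _ := h4
  nlinarith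

end PuncturedMinorant

/-! ### A convexity inequality on the line -/

/-- Boundedness on bounded subsets of the line. -/
def LocallyBdd (g : ℝ → ℝ) : Prop := ∀ T, ∃ B, ∀ t, |t| ≤ T → |g t| ≤ B

lemma locallyBdd_of_continuous {g : ℝ → ℝ} (hg : Continuous g) : LocallyBdd g := by
  intro T
  obtain ⟨B, hB⟩ := (isCompact_Icc (a := -T) (b := T)).exists_bound_of_continuousOn hg.continuousOn
  exact ⟨B, fun t ht => hB t (abs_le.1 ht)⟩

lemma LocallyBdd.intervalIntegrable {g : ℝ → ℝ} (hg : LocallyBdd g) (hm : Measurable g) (a b : ℝ) :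
    IntervalIntegrable g volume a b := by
  obtain ⟨B, hB⟩ := hg (max |a| |b|)
  refine (intervalIntegrable_const (c := B)).mono_fun hm.aestronglyMeasurable ?_
  refine (ae_restrict_iff' measurableSet_uIoc).2 (Eventually.of_forall fun t ht => ?_)
  have h := uIoc_subset_uIcc ht
  rw [mem_uIcc] at h
  have hle : |t| ≤ max |a| |b| := by
    rcases h with h | h
    · exact abs_le_max_abs_abs h.1 h.2
    · rw [max_comm]; exact abs_le_max_abs_abs h.1 h.2
  exact (hB t hle).trans (le_abs_self B)

lemma integrable_uncurry_of_bounded {Ω : Type*} [MeasurableSpace Ω] {ν : Measure Ω}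
    [IsFiniteMeasure ν] {f : ℝ → Ω → ℝ} (hf : Measurable (Function.uncurry f)) {a b B : ℝ}
    (hB : ∀ t ∈ uIoc a b, ∀ ω, |f t ω| ≤ B) :
    Integrable (Function.uncurry f) ((volume.restrict (uIoc a b)).prod ν) := by
  have : IsFiniteMeasure (volume.restrict (uIoc a b)) := by unfold uIoc; infer_instance
  refine Integrable.of_bound hf.aestronglyMeasurable B ?_
  rw [← Measure.restrict_univ (μ := ν), Measure.prod_restrict]
  refine (ae_restrict_iff' (measurableSet_uIoc.prod MeasurableSet.univ)).2
    (Eventually.of_forall fun p hp => hB p.1 hp.1 p.2)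

/-- The second difference with step `N` of the double primitive of `g`; equivalently, the integral
of `g` against the tent function of base `[y - N, y + N]` and height `N`. -/
noncomputable def tentIntegral (g : ℝ → ℝ) (N y : ℝ) : ℝ :=
  ∫ s in (0 : ℝ)..N, ∫ t in (y - s)..(y + s), g t

lemma le_quadratic_of_deriv_bounds {f f' : ℝ → ℝ} {δ a S : ℝ}
    (hf : ∀ y, HasDerivAt f (f' y) y)
    (h1 : ∀ y, 0 ≤ y → y ≤ δ → f' y ≤ a + S * y) (h2 : ∀ y, y ≤ 0 → -δ ≤ y → a + S * y ≤ f' y)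
    {x : ℝ} (hx : |x| ≤ δ) : f x ≤ f 0 + a * x + S * x ^ 2 / 2 := by
  have hx' := abs_le.1 hx
  have hk : ∀ y, HasDerivAt (fun y => f y - a * y - S * y ^ 2 / 2) (f' y - (a + S * y)) y := by
    intro y
    have := ((hf y).sub ((hasDerivAt_id y).const_mul a)).sub
      ((((hasDerivAt_id y).pow 2).const_mul S).div_const 2)
    convert! this using 1
    simp; ring
  have hd : Differentiable ℝ (fun y => f y - a * y - S * y ^ 2 / 2) :=
    fun y => (hk y).differentiableAt
  rcases le_total 0 x with h0 | h0
  · have := (convex_Icc 0 x).image_sub_le_mul_sub_of_deriv_le hd.continuous.continuousOn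
      hd.differentiableOn (C := 0) (fun y hy => ?_) 0 (left_mem_Icc.2 h0) x (right_mem_Icc.2 h0) h0
    · linarith
    · rw [interior_Icc] at hy
      rw [(hk y).deriv]
      have := h1 y hy.1.le (hy.2.le.trans hx'.2)
      linarith
  · have := (convex_Icc x 0).mul_sub_le_image_sub_of_le_deriv hd.continuous.continuousOn
      hd.differentiableOn (C := 0) (fun y hy => ?_) x (left_mem_Icc.2 h0) 0 (right_mem_Icc.2 h0) h0
    · linarith
    · rw [interior_Icc] at hy
      rw [(hk y).deriv]
      have := h2 y hy.2.le (hx'.1.trans hy.1.le)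
      linarith

lemma hasDerivAt_tentIntegral {g : ℝ → ℝ} (hg : LocallyBdd g) (hm : Measurable g) (N y : ℝ) :
    HasDerivAt (tentIntegral g N) ((∫ t in y..(y + N), g t) - ∫ t in (y - N)..y, g t) y := by
  have hi := hg.intervalIntegrable hm
  set F : ℝ → ℝ := fun t => ∫ u in (0 : ℝ)..t, g u with hF
  have hFc : Continuous F := intervalIntegral.continuous_primitive hi 0
  have hFsub : ∀ a b, ∫ t in a..b, g t = F b - F a := fun a b =>
    (intervalIntegral.integral_interval_sub_left (hi _ _) (hi _ _)).symm
  set G : ℝ → ℝ := fun t => ∫ u in (0 : ℝ)..t, F u with hG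
  have hGd : ∀ t, HasDerivAt G (F t) t := fun t =>
    intervalIntegral.integral_hasDerivAt_right (hFc.intervalIntegrable _ _)
      (hFc.stronglyMeasurableAtFilter _ _) hFc.continuousAt
  have hGsub : ∀ a b, ∫ t in a..b, F t = G b - G a := fun a b =>
    (intervalIntegral.integral_interval_sub_left (hFc.intervalIntegrable _ _)
      (hFc.intervalIntegrable _ _)).symm
  have hT : tentIntegral g N = fun y => G (y + N) + G (y - N) - 2 * G y := by
    funext y
    unfold tentIntegral
    simp_rw [hFsub]
    rw [intervalIntegral.integral_sub
      (Continuous.intervalIntegrable (by fun_prop) _ _)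
      (Continuous.intervalIntegrable (by fun_prop) _ _)]
    rw [intervalIntegral.integral_comp_add_left, intervalIntegral.integral_comp_sub_left, hGsub,
      hGsub]
    simp; ring
  rw [hT]
  have h := (((hGd (y + N)).comp_add_const y N).add ((hGd (y - N)).comp_sub_const y N)).sub
    ((hGd y).const_mul 2)
  refine h.congr_deriv ?_
  rw [hFsub, hFsub]; ring

/-- Let the random shift `x` have mean zero, and let `J t` be at most the expectation of
`J (t + x) + 2 x I (t + x) + x²` for all `t`. This is a discrete form of `J'' + 4 I' + 2 ≥ 0`;
integrating it against a tent function of base `[-N, N]` bounds the difference of the integrals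
of `I` over `[-N, 0]` and `[0, N]` by the values of `J` near `-N` and `N`. -/
theorem two_mul_le_of_shift_inequality {Ω : Type*} [MeasurableSpace Ω] {ν : Measure Ω}
    [IsProbabilityMeasure ν] {x : Ω → ℝ} (hx : Measurable x) {δ : ℝ} (hxδ : ∀ ω, |x ω| ≤ δ)
    (hx0 : ∫ ω, x ω ∂ν = 0) (hx2 : 0 < ∫ ω, x ω ^ 2 ∂ν) {J I : ℝ → ℝ} (hJm : Measurable J)
    (hIm : Measurable I) (hJb : LocallyBdd J) (hIb : LocallyBdd I) (hJ0 : ∀ t, 0 ≤ J t)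
    (hJI : ∀ t, J t ≤ ∫ ω, (J (t + x ω) + 2 * x ω * I (t + x ω) + x ω ^ 2) ∂ν)
    {N : ℝ} (hN : 0 < N) {S₁ S₂ L : ℝ} (hS₁ : ∀ t, |t + N| ≤ δ → J t ≤ S₁)
    (hS₂ : ∀ t, |t - N| ≤ δ → J t ≤ S₂)
    (hL : ∀ y, |y| ≤ δ → L ≤ (∫ t in (y - N)..y, I t) - ∫ t in y..(y + N), I t) :
    2 * L ≤ (S₁ + S₂) / 2 + N ^ 2 := by
  have hiJ := hJb.intervalIntegrable hJm
  have hiI := hIb.intervalIntegrable hIm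
  set σ := ∫ ω, x ω ^ 2 ∂ν with hσ
  -- The hypothesis is integrated over `[-s, s]` and then over `0 ≤ s ≤ N`.
  have htest : tentIntegral J N 0 ≤
      ∫ ω, (tentIntegral J N (x ω) + 2 * x ω * tentIntegral I N (x ω) + N ^ 2 * x ω ^ 2) ∂ν := by
    have hΩ : Nonempty Ω := ν.nonempty_of_neZero
    have hδ : 0 ≤ δ := (abs_nonneg _).trans (hxδ hΩ.some)
    obtain ⟨B₁, hB₁⟩ := hJb (N + δ)
    obtain ⟨B₂, hB₂⟩ := hIb (N + δ)
    have hB₂0 : 0 ≤ B₂ := (abs_nonneg _).trans (hB₂ 0 (by simpa using by linarith))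
    have hprim : ∀ {g : ℝ → ℝ}, (∀ a b, IntervalIntegrable g volume a b) →
        Measurable (Function.uncurry fun (s : ℝ) ω => ∫ t in (x ω - s)..(x ω + s), g t) ∧
        (∀ y, Continuous fun s : ℝ => ∫ t in (y - s)..(y + s), g t) ∧
        ∃ C, ∀ s ∈ uIoc 0 N, ∀ ω, |∫ t in (x ω - s)..(x ω + s), g t| ≤ C := by
      intro g hg
      obtain ⟨F, hFc, hFsub⟩ : ∃ F : ℝ → ℝ, Continuous F ∧ ∀ a b, ∫ t in a..b, g t = F b - F a :=
        ⟨fun t => ∫ u in (0 : ℝ)..t, g u, intervalIntegral.continuous_primitive hg 0,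
          fun a b => (intervalIntegral.integral_interval_sub_left (hg _ _) (hg _ _)).symm⟩
      obtain ⟨C, hC⟩ := locallyBdd_of_continuous hFc (N + δ)
      refine ⟨?_, ?_, C + C, ?_⟩
      · simp_rw [hFsub]
        exact (hFc.measurable.comp ((hx.comp measurable_snd).add measurable_fst)).sub
          (hFc.measurable.comp ((hx.comp measurable_snd).sub measurable_fst))
      · intro y
        simp_rw [hFsub]
        fun_prop
      · intro s hs ω
        rw [uIoc_of_le hN.le] at hs
        have hω := abs_le.1 (hxδ ω)
        rw [hFsub]
        refine (abs_sub _ _).trans (add_le_add (hC _ ?_) (hC _ ?_)) <;>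
        exact abs_le.2 ⟨by linarith [hs.1, hs.2], by linarith [hs.1, hs.2]⟩
    obtain ⟨mJ, cJ, CJ, hCJ⟩ := hprim hiJ
    obtain ⟨mI, cI, CI, hCI⟩ := hprim hiI
    have hstep : ∀ s, 0 ≤ s → s ≤ N → ∫ t in (0 - s)..(0 + s), J t ≤
        ∫ ω, ((∫ t in (x ω - s)..(x ω + s), J t) + 2 * x ω * (∫ t in (x ω - s)..(x ω + s), I t) +
          2 * s * x ω ^ 2) ∂ν := by
      intro s hs hsN
      have hm : Measurable (Function.uncurry
          fun (t : ℝ) ω => J (t + x ω) + 2 * x ω * I (t + x ω) + x ω ^ 2) := by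
        have hx' : Measurable fun p : ℝ × Ω => x p.2 := hx.comp measurable_snd
        have h1 : Measurable fun p : ℝ × Ω => p.1 + x p.2 := measurable_fst.add hx'
        exact ((hJm.comp h1).add ((hx'.const_mul 2).mul (hIm.comp h1))).add (hx'.pow_const 2)
      have hb : ∀ t ∈ uIoc (0 - s) (0 + s), ∀ ω,
          |J (t + x ω) + 2 * x ω * I (t + x ω) + x ω ^ 2| ≤ B₁ + 2 * δ * B₂ + δ ^ 2 := by
        intro t ht ω
        rw [uIoc_of_le (by linarith)] at ht
        have hω := abs_le.1 (hxδ ω)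
        have ht' : |t + x ω| ≤ N + δ :=
          abs_le.2 ⟨by linarith [ht.1, ht.2], by linarith [ht.1, ht.2]⟩
        refine (abs_add_three _ _ _).trans ?_
        have h1 : |2 * x ω * I (t + x ω)| ≤ 2 * δ * B₂ := by
          rw [abs_mul, abs_mul, abs_two]
          exact mul_le_mul (by linarith [hxδ ω]) (hB₂ _ ht') (abs_nonneg _) (by positivity)
        have h2 : |x ω ^ 2| ≤ δ ^ 2 := by
          rw [abs_pow]; exact pow_le_pow_left₀ (abs_nonneg _) (hxδ ω) 2
        linarith [hB₁ _ ht']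
      have hint := integrable_uncurry_of_bounded (ν := ν) hm hb
      have hΦ : IntervalIntegrable (fun t => ∫ ω, (J (t + x ω) + 2 * x ω * I (t + x ω) + x ω ^ 2) ∂ν)
          volume (0 - s) (0 + s) :=
        intervalIntegrable_iff.2 hint.integral_prod_left
      calc ∫ t in (0 - s)..(0 + s), J t
          ≤ ∫ t in (0 - s)..(0 + s), (∫ ω, (J (t + x ω) + 2 * x ω * I (t + x ω) + x ω ^ 2) ∂ν) :=
            intervalIntegral.integral_mono_on (by linarith) (hiJ _ _) hΦ fun t _ => hJI t
        _ = ∫ ω, (∫ t in (0 - s)..(0 + s), (J (t + x ω) + 2 * x ω * I (t + x ω) + x ω ^ 2)) ∂ν :=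
            intervalIntegral_integral_swap hint
        _ = _ := by
            refine integral_congr_ae (Eventually.of_forall fun ω => ?_)
            have i1 : IntervalIntegrable (fun t => J (t + x ω)) volume (0 - s) (0 + s) := by
              simpa using (hiJ (0 - s + x ω) (0 + s + x ω)).comp_add_right (x ω)
            have i2 : IntervalIntegrable (fun t => I (t + x ω)) volume (0 - s) (0 + s) := by
              simpa using (hiI (0 - s + x ω) (0 + s + x ω)).comp_add_right (x ω)
            simp only
            rw [intervalIntegral.integral_add (i1.add (i2.const_mul _)) intervalIntegrable_const,
              intervalIntegral.integral_add i1 (i2.const_mul _),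
              intervalIntegral.integral_const_mul, intervalIntegral.integral_comp_add_right,
              intervalIntegral.integral_comp_add_right, intervalIntegral.integral_const, smul_eq_mul,
              show 0 - s + x ω = x ω - s by ring, show 0 + s + x ω = x ω + s by ring]
            ring
    have hm : Measurable (Function.uncurry fun (s : ℝ) ω => (∫ t in (x ω - s)..(x ω + s), J t) +
        2 * x ω * (∫ t in (x ω - s)..(x ω + s), I t) + 2 * s * x ω ^ 2) := by
      have hx' : Measurable fun p : ℝ × Ω => x p.2 := hx.comp measurable_snd
      exact (mJ.add ((hx'.const_mul 2).mul mI)).add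
        ((measurable_fst.const_mul 2).mul (hx'.pow_const 2))
    have hb : ∀ s ∈ uIoc 0 N, ∀ ω, |(∫ t in (x ω - s)..(x ω + s), J t) +
        2 * x ω * (∫ t in (x ω - s)..(x ω + s), I t) + 2 * s * x ω ^ 2| ≤
          CJ + 2 * δ * CI + 2 * N * δ ^ 2 := by
      intro s hs ω
      have h3 := hCJ s hs ω
      have h4 := hCI s hs ω
      rw [uIoc_of_le hN.le] at hs
      refine (abs_add_three _ _ _).trans ?_
      have h1 : |2 * x ω * ∫ t in (x ω - s)..(x ω + s), I t| ≤ 2 * δ * CI := by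
        rw [abs_mul, abs_mul, abs_two]
        exact mul_le_mul (by linarith [hxδ ω]) h4 (abs_nonneg _) (by positivity)
      have h2 : |2 * s * x ω ^ 2| ≤ 2 * N * δ ^ 2 := by
        rw [abs_mul, abs_mul, abs_two, abs_of_pos hs.1, abs_pow]
        exact mul_le_mul (by linarith [hs.2]) (pow_le_pow_left₀ (abs_nonneg _) (hxδ ω) 2)
          (by positivity) (by positivity)
      linarith
    have hint := integrable_uncurry_of_bounded (ν := ν) hm hb
    calc tentIntegral J N 0 ≤ ∫ s in (0:ℝ)..N, (∫ ω, ((∫ t in (x ω - s)..(x ω + s), J t) +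
          2 * x ω * (∫ t in (x ω - s)..(x ω + s), I t) + 2 * s * x ω ^ 2) ∂ν) :=
          intervalIntegral.integral_mono_on hN.le ((cJ 0).intervalIntegrable _ _)
            (intervalIntegrable_iff.2 hint.integral_prod_left) fun s hs => hstep s hs.1 hs.2
      _ = ∫ ω, (∫ s in (0:ℝ)..N, ((∫ t in (x ω - s)..(x ω + s), J t) +
          2 * x ω * (∫ t in (x ω - s)..(x ω + s), I t) + 2 * s * x ω ^ 2)) ∂ν :=
          intervalIntegral_integral_swap hint
      _ = _ := by
          refine integral_congr_ae (Eventually.of_forall fun ω => ?_)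
          have i1 := (cJ (x ω)).intervalIntegrable (μ := volume) 0 N
          have i2 := ((cI (x ω)).intervalIntegrable (μ := volume) 0 N).const_mul (2 * x ω)
          have i3 : IntervalIntegrable (fun s => 2 * s * x ω ^ 2) volume 0 N :=
            Continuous.intervalIntegrable (by fun_prop) _ _
          simp only
          rw [intervalIntegral.integral_add (i1.add i2) i3, intervalIntegral.integral_add i1 i2,
            intervalIntegral.integral_const_mul, intervalIntegral.integral_mul_const,
            intervalIntegral.integral_const_mul, integral_id]
          simp only [tentIntegral]
          ring
  -- Taylor expansions of the two tent integrals
  have hJt : ∀ y, |y| ≤ δ → tentIntegral J N y ≤ tentIntegral J N 0 +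
      ((∫ t in (0:ℝ)..(0 + N), J t) - ∫ t in (0 - N)..0, J t) * y + (S₁ + S₂) * y ^ 2 / 2 := by
    intro y hy
    have hsplit : ∀ y, ((∫ t in y..(y + N), J t) - ∫ t in (y - N)..y, J t) =
        ((∫ t in (0:ℝ)..(0 + N), J t) - ∫ t in (0 - N)..0, J t) +
          ((∫ t in N..(y + N), J t) + (∫ t in (-N)..(y - N), J t) - 2 * ∫ t in (0:ℝ)..y, J t) := by
      intro y
      have e1 := intervalIntegral.integral_add_adjacent_intervals (hiJ 0 y) (hiJ y (y + N))
      have e2 := intervalIntegral.integral_add_adjacent_intervals (hiJ 0 N) (hiJ N (y + N))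
      have e3 := intervalIntegral.integral_add_adjacent_intervals (hiJ (-N) (y - N)) (hiJ (y - N) y)
      have e4 := intervalIntegral.integral_add_adjacent_intervals (hiJ (-N) 0) (hiJ 0 y)
      rw [zero_add, zero_sub]
      linarith
    refine le_quadratic_of_deriv_bounds (hasDerivAt_tentIntegral hJb hJm N) ?_ ?_ hy
    · intro z hz hzδ
      rw [hsplit z]
      have b1 : (∫ t in N..(z + N), J t) ≤ ∫ t in N..(z + N), S₂ :=
        intervalIntegral.integral_mono_on (by linarith) (hiJ _ _) intervalIntegrable_const
          fun t ht => hS₂ t (abs_le.2 ⟨by linarith [ht.1], by linarith [ht.2]⟩)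
      have b2 : (∫ t in (-N)..(z - N), J t) ≤ ∫ t in (-N)..(z - N), S₁ :=
        intervalIntegral.integral_mono_on (by linarith) (hiJ _ _) intervalIntegrable_const
          fun t ht => hS₁ t (abs_le.2 ⟨by linarith [ht.1], by linarith [ht.2]⟩)
      have b3 : 0 ≤ ∫ t in (0:ℝ)..z, J t :=
        intervalIntegral.integral_nonneg hz fun t _ => hJ0 t
      simp only [intervalIntegral.integral_const, smul_eq_mul] at b1 b2
      linarith
    · intro z hz hzδ
      rw [hsplit z, intervalIntegral.integral_symm (z + N) N,
        intervalIntegral.integral_symm (z - N) (-N), intervalIntegral.integral_symm z 0]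
      have b1 : (∫ t in (z + N)..N, J t) ≤ ∫ t in (z + N)..N, S₂ :=
        intervalIntegral.integral_mono_on (by linarith) (hiJ _ _) intervalIntegrable_const
          fun t ht => hS₂ t (abs_le.2 ⟨by linarith [ht.1], by linarith [ht.2]⟩)
      have b2 : (∫ t in (z - N)..(-N), J t) ≤ ∫ t in (z - N)..(-N), S₁ :=
        intervalIntegral.integral_mono_on (by linarith) (hiJ _ _) intervalIntegrable_const
          fun t ht => hS₁ t (abs_le.2 ⟨by linarith [ht.1], by linarith [ht.2]⟩)
      have b3 : 0 ≤ ∫ t in z..(0:ℝ), J t :=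
        intervalIntegral.integral_nonneg hz fun t _ => hJ0 t
      simp only [intervalIntegral.integral_const, smul_eq_mul] at b1 b2
      linarith
  have hIt : ∀ y, |y| ≤ δ → y * tentIntegral I N y ≤ y * tentIntegral I N 0 - L * y ^ 2 := by
    intro y hy
    have hy' := abs_le.1 hy
    have hd : Differentiable ℝ (tentIntegral I N) :=
      fun y => (hasDerivAt_tentIntegral hIb hIm N y).differentiableAt
    have hderiv : ∀ z, |z| ≤ δ → deriv (tentIntegral I N) z ≤ -L := by
      intro z hz
      rw [(hasDerivAt_tentIntegral hIb hIm N z).deriv]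
      have := hL z hz
      linarith
    rcases le_total 0 y with h0 | h0
    · have := (convex_Icc 0 y).image_sub_le_mul_sub_of_deriv_le hd.continuous.continuousOn
        hd.differentiableOn (C := -L) (fun z hz => ?_) 0 (left_mem_Icc.2 h0) y (right_mem_Icc.2 h0) h0
      · nlinarith
      · rw [interior_Icc] at hz
        exact hderiv z (abs_le.2 ⟨by linarith [hz.1], by linarith [hz.2]⟩)
    · have := (convex_Icc y 0).image_sub_le_mul_sub_of_deriv_le hd.continuous.continuousOn
        hd.differentiableOn (C := -L) (fun z hz => ?_) y (left_mem_Icc.2 h0) 0 (right_mem_Icc.2 h0) h0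
      · nlinarith
      · rw [interior_Icc] at hz
        exact hderiv z (abs_le.2 ⟨by linarith [hz.1], by linarith [hz.2]⟩)
  set a := (∫ t in (0:ℝ)..(0 + N), J t) - ∫ t in (0 - N)..0, J t with ha
  have hcont : ∀ {g : ℝ → ℝ}, LocallyBdd g → Measurable g → Continuous (tentIntegral g N) :=
    fun hb hm => (show Differentiable ℝ (tentIntegral _ N) from
      fun y => (hasDerivAt_tentIntegral hb hm N y).differentiableAt).continuous
  have hbdd : ∀ {g : ℝ → ℝ}, Continuous g → Integrable (fun ω => g (x ω)) ν := by
    intro g hg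
    obtain ⟨B, hB⟩ := locallyBdd_of_continuous hg δ
    exact Integrable.of_bound (hg.measurable.comp hx).aestronglyMeasurable B
      (Eventually.of_forall fun ω => hB _ (hxδ ω))
  have hcJ := hcont hJb hJm
  have hcI := hcont hIb hIm
  have hfin : ∫ ω, (tentIntegral J N (x ω) + 2 * x ω * tentIntegral I N (x ω) + N ^ 2 * x ω ^ 2) ∂ν ≤
      ∫ ω, (tentIntegral J N 0 + (a + 2 * tentIntegral I N 0) * x ω +
        ((S₁ + S₂) / 2 - 2 * L + N ^ 2) * x ω ^ 2) ∂ν := by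
    refine integral_mono
      (hbdd (g := fun y => tentIntegral J N y + 2 * y * tentIntegral I N y + N ^ 2 * y ^ 2)
        (by fun_prop))
      (hbdd (g := fun y => tentIntegral J N 0 + (a + 2 * tentIntegral I N 0) * y +
        ((S₁ + S₂) / 2 - 2 * L + N ^ 2) * y ^ 2) (by fun_prop)) fun ω => ?_
    have h1 := hJt _ (hxδ ω)
    have h2 := hIt _ (hxδ ω)
    simp only
    linarith
  have i1 : Integrable (fun ω => (a + 2 * tentIntegral I N 0) * x ω) ν :=
    hbdd (g := fun y => (a + 2 * tentIntegral I N 0) * y) (by fun_prop)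
  have i2 : Integrable (fun ω => ((S₁ + S₂) / 2 - 2 * L + N ^ 2) * x ω ^ 2) ν :=
    hbdd (g := fun y => ((S₁ + S₂) / 2 - 2 * L + N ^ 2) * y ^ 2) (by fun_prop)
  have i0 : Integrable (fun _ : Ω => tentIntegral J N 0) ν := integrable_const _
  have i01 : Integrable (fun ω => tentIntegral J N 0 + (a + 2 * tentIntegral I N 0) * x ω) ν :=
    i0.add i1
  rw [integral_add i01 i2, integral_add i0 i1, integral_const_mul, integral_const_mul, hx0,
    integral_const, ← hσ] at hfin
  simp only [probReal_univ, one_smul] at hfin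
  have : 0 ≤ ((S₁ + S₂) / 2 - 2 * L + N ^ 2) * σ := by linarith
  have := nonneg_of_mul_nonneg_left this hx2
  linarith

/-! ### Radial means and averages over multiplicative circles -/

/-- The uniform probability measure on the angles `(0, 2π]`. -/
noncomputable def angleMeasure : Measure ℝ :=
  ENNReal.ofReal (2 * π)⁻¹ • volume.restrict (Ioc 0 (2 * π))

instance : IsProbabilityMeasure angleMeasure := by
  constructor
  rw [angleMeasure, Measure.smul_apply, Measure.restrict_apply_univ, Real.volume_Ioc, sub_zero,
    smul_eq_mul, ← ENNReal.ofReal_mul (by positivity), inv_mul_cancel₀ (by positivity),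
    ENNReal.ofReal_one]

lemma circleAverage_eq_integral_angleMeasure (f : ℂ → ℝ) (c : ℂ) (R : ℝ) :
    circleAverage f c R = ∫ θ, f (circleMap c R θ) ∂angleMeasure := by
  rw [circleAverage, angleMeasure, integral_smul_measure, ENNReal.toReal_ofReal (by positivity),
    intervalIntegral.integral_of_le (by positivity)]

lemma mul_circleMap (z c : ℂ) (r θ : ℝ) :
    z * circleMap c r θ = circleMap (z * c) (r * ‖z‖) (θ + z.arg) := by
  have h := Complex.norm_mul_exp_arg_mul_I z
  simp only [circleMap, mul_add]
  congr 1
  push_cast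
  rw [add_mul, Complex.exp_add]
  conv_lhs => rw [← h]
  ring

lemma circleAverage_comp_mul (g : ℂ → ℝ) (z c : ℂ) (r : ℝ) :
    circleAverage (fun w => g (z * w)) c r = circleAverage g (z * c) (r * ‖z‖) := by
  rw [circleAverage_eq_integral_add (f := g) z.arg, circleAverage]
  simp_rw [mul_circleMap]

/-- The mean of `g` over the circle `‖z‖ = exp t`. -/
noncomputable def radialMean (g : ℂ → ℝ) (t : ℝ) : ℝ := circleAverage g 0 (Real.exp t)

lemma radialMean_comp_inv (g : ℂ → ℝ) (t : ℝ) :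
    radialMean (fun z => g z⁻¹) t = radialMean g (-t) := by
  have h := circleAverage_zero_one_congr_inv (f := fun z => g (((Real.exp (-t) : ℝ) : ℂ) * z))
  rw [radialMean, radialMean, circleAverage_eq_circleAverage_zero_one,
    circleAverage_eq_circleAverage_zero_one (f := g)]
  simp only [add_zero]
  rw [← h]
  congr 1
  funext z
  rw [mul_inv, ← Complex.ofReal_inv, ← Real.exp_neg]

lemma radialMean_comp_mul (g : ℂ → ℝ) {u : ℂ} (hu : u ≠ 0) (t : ℝ) :
    radialMean (fun z => g (z * u)) t = radialMean g (t + Real.log ‖u‖) := by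
  simp_rw [radialMean, mul_comm _ u]
  rw [circleAverage_comp_mul, mul_zero, Real.exp_add, Real.exp_log (norm_pos_iff.2 hu)]

lemma measurable_radialMean {g : ℂ → ℝ} (hg : Measurable g) : Measurable (radialMean g) := by
  unfold radialMean
  simp_rw [circleAverage_eq_integral_angleMeasure]
  refine (StronglyMeasurable.integral_prod_right (f := fun t θ => g (circleMap 0 (Real.exp t) θ))
    (Measurable.stronglyMeasurable (hg.comp ?_))).measurable
  have : Continuous fun p : ℝ × ℝ => circleMap 0 (Real.exp p.1) p.2 := by
    unfold circleMap; fun_prop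
  exact this.measurable

lemma norm_circleMap_exp (t θ : ℝ) : ‖circleMap 0 (Real.exp t) θ‖ = Real.exp t := by
  simp

lemma circleMap_exp_ne_zero (t θ : ℝ) : circleMap 0 (Real.exp t) θ ≠ 0 := by
  rw [← norm_pos_iff, norm_circleMap_exp]; exact Real.exp_pos t

lemma abs_radialMean_le {g : ℂ → ℝ} {t B : ℝ} (hB : ∀ z, ‖z‖ = Real.exp t → |g z| ≤ B) :
    |radialMean g t| ≤ B := by
  rw [radialMean, circleAverage_eq_integral_angleMeasure]
  have := norm_integral_le_of_norm_le_const (μ := angleMeasure) (C := B)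
    (f := fun θ => g (circleMap 0 (Real.exp t) θ))
    (Eventually.of_forall fun θ => hB _ (norm_circleMap_exp t θ))
  simpa using this

lemma integrable_comp_circleMap {g : ℂ → ℝ} (hg : Measurable g) {c : ℂ} {r B : ℝ}
    (hB : ∀ θ, |g (circleMap c r θ)| ≤ B) :
    Integrable (fun θ => g (circleMap c r θ)) angleMeasure :=
  Integrable.of_bound (hg.comp (continuous_circleMap c r).measurable).aestronglyMeasurable B
    (Eventually.of_forall hB)

lemma radialMean_mono {g h : ℂ → ℝ} (hg : Measurable g) (hh : Measurable h) {t B : ℝ}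
    (hgB : ∀ z, ‖z‖ = Real.exp t → |g z| ≤ B) (hhB : ∀ z, ‖z‖ = Real.exp t → |h z| ≤ B)
    (hle : ∀ z, ‖z‖ = Real.exp t → g z ≤ h z) : radialMean g t ≤ radialMean h t := by
  simp only [radialMean, circleAverage_eq_integral_angleMeasure]
  exact integral_mono (integrable_comp_circleMap hg fun θ => hgB _ (norm_circleMap_exp t θ))
    (integrable_comp_circleMap hh fun θ => hhB _ (norm_circleMap_exp t θ))
    fun θ => hle _ (norm_circleMap_exp t θ)

/-- The logarithm of `‖1 + r e^{iθ}‖`. -/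
noncomputable def logShift (r θ : ℝ) : ℝ := Real.log ‖circleMap 1 r θ‖

section logShift

variable {r : ℝ}

lemma circleMap_one_norm_bounds (hr0 : 0 < r) (θ : ℝ) :
    1 - r ≤ ‖circleMap 1 r θ‖ ∧ ‖circleMap 1 r θ‖ ≤ 1 + r := by
  have h : ‖circleMap 1 r θ - 1‖ = r := by
    simp [circleMap, abs_of_pos hr0]
  have h1 := norm_sub_norm_le (1 : ℂ) (circleMap 1 r θ)
  have h2 := norm_le_norm_add_norm_sub' (circleMap 1 r θ) 1
  rw [norm_sub_rev, h, norm_one] at h1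
  rw [h, norm_one] at h2
  constructor <;> linarith

lemma circleMap_one_ne_zero (hr0 : 0 < r) (hr1 : r < 1) (θ : ℝ) : circleMap 1 r θ ≠ 0 := by
  rw [← norm_pos_iff]
  linarith [(circleMap_one_norm_bounds hr0 θ).1]

lemma abs_logShift_le (hr0 : 0 < r) (hr1 : r < 1) (θ : ℝ) :
    |logShift r θ| ≤ -Real.log (1 - r) := by
  obtain ⟨h1, h2⟩ := circleMap_one_norm_bounds hr0 θ
  have h3 : 0 < 1 - r := by linarith
  rw [abs_le, neg_neg]
  refine ⟨Real.log_le_log h3 h1, ?_⟩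
  rw [← Real.log_inv]
  refine Real.log_le_log (h3.trans_le h1) (h2.trans ?_)
  rw [le_inv_comm₀ (by linarith) h3, ← one_div, le_div_iff₀ (by linarith)]
  nlinarith

lemma continuous_logShift (hr0 : 0 < r) (hr1 : r < 1) : Continuous (logShift r) := by
  unfold logShift
  refine Continuous.log (by fun_prop) fun θ => ?_
  rw [norm_ne_zero_iff]; exact circleMap_one_ne_zero hr0 hr1 θ

lemma integral_logShift (hr0 : 0 < r) (hr1 : r < 1) : ∫ θ, logShift r θ ∂angleMeasure = 0 := by
  have h := circleAverage_log_norm_eq (c := 1) hr0 (by simpa using hr1)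
  rw [circleAverage_eq_integral_angleMeasure] at h
  simpa [logShift] using h

lemma integral_logShift_sq_pos (hr0 : 0 < r) (hr1 : r < 1) :
    0 < ∫ θ, logShift r θ ^ 2 ∂angleMeasure := by
  have hc := continuous_logShift hr0 hr1
  rw [angleMeasure, integral_smul_measure, ENNReal.toReal_ofReal (by positivity),
    ← intervalIntegral.integral_of_le (by positivity), smul_eq_mul]
  refine mul_pos (by positivity) ?_
  refine intervalIntegral.integral_pos (by positivity) (by fun_prop)
    (fun θ _ => sq_nonneg _) ⟨0, ⟨le_rfl, by positivity⟩, ?_⟩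
  have h1 : circleMap 1 r 0 = ((1 + r : ℝ) : ℂ) := by simp [circleMap]
  have h2 : 0 < logShift r 0 := by
    rw [logShift, h1, Complex.norm_real, Real.norm_of_nonneg (by linarith)]
    exact Real.log_pos (by linarith)
  positivity

end logShift

/-- If `W` moves away from `0` under averaging over the multiplicative circle `z (1 + r e^{iθ})`,
then the radial means of `W` and `W²` satisfy the inequality of
`two_mul_le_of_shift_inequality`. -/
theorem radialMean_sq_le {W : ℂ → ℝ} (hWm : Measurable W) {c : ℝ}
    (hWb : ∀ z, z ≠ 0 → |W z| ≤ c + |Real.log ‖z‖|) {r : ℝ} (hr0 : 0 < r) (hr1 : r < 1)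
    (hW : ∀ z, z ≠ 0 → W z * W z ≤ W z * circleAverage W z (r * ‖z‖)) (t : ℝ) :
    radialMean (fun z => W z ^ 2) t ≤ ∫ θ, (radialMean (fun z => W z ^ 2) (t + logShift r θ) +
      2 * logShift r θ * radialMean W (t + logShift r θ) + logShift r θ ^ 2) ∂angleMeasure := by
  set δ := -Real.log (1 - r) with hδ
  have hxδ := abs_logShift_le hr0 hr1
  have hm0 := circleMap_one_ne_zero hr0 hr1
  have hxc := continuous_logShift hr0 hr1
  have hbound : ∀ z, z ≠ 0 → ∀ θ, |W (z * circleMap 1 r θ)| ≤ c + (|Real.log ‖z‖| + δ) := by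
    intro z hz θ
    refine (hWb _ (mul_ne_zero hz (hm0 θ))).trans ?_
    rw [norm_mul, Real.log_mul (norm_ne_zero_iff.2 hz) (norm_ne_zero_iff.2 (hm0 θ))]
    have := abs_add_le (Real.log ‖z‖) (Real.log ‖circleMap 1 r θ‖)
    have h2 : |Real.log ‖circleMap 1 r θ‖| ≤ δ := hxδ θ
    linarith
  -- This is `(W(zm) + log ‖m‖ - W z)² ≥ 0`, averaged over `m`; the mean of `log ‖m‖` is zero.
  have hpt : ∀ z, z ≠ 0 → W z ^ 2 ≤ ∫ θ, (W (z * circleMap 1 r θ) + logShift r θ) ^ 2 ∂angleMeasure := by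
    intro z hz
    have i1 : Integrable (fun θ => W (z * circleMap 1 r θ)) angleMeasure :=
      integrable_comp_circleMap (hWm.comp (measurable_const_mul z)) (hbound z hz)
    have i2 : Integrable (logShift r) angleMeasure :=
      Integrable.of_bound hxc.aestronglyMeasurable δ (Eventually.of_forall hxδ)
    have i12 : Integrable (fun θ => W (z * circleMap 1 r θ) + logShift r θ) angleMeasure := i1.add i2
    have i3 : Integrable (fun θ => (W (z * circleMap 1 r θ) + logShift r θ) ^ 2) angleMeasure := by
      refine Integrable.of_bound (i12.aestronglyMeasurable.pow 2)
        ((c + (|Real.log ‖z‖| + δ) + δ) ^ 2) (Eventually.of_forall fun θ => ?_)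
      rw [norm_pow]
      refine pow_le_pow_left₀ (norm_nonneg _) ?_ 2
      exact (norm_add_le _ _).trans (add_le_add (hbound z hz θ) (hxδ θ))
    have hA : ∫ θ, W (z * circleMap 1 r θ) ∂angleMeasure = circleAverage W z (r * ‖z‖) := by
      rw [← circleAverage_eq_integral_angleMeasure (fun u => W (z * u)), circleAverage_comp_mul,
        mul_one]
    have h1 : ∫ θ, (2 * W z * (W (z * circleMap 1 r θ) + logShift r θ) - W z ^ 2) ∂angleMeasure ≤
        ∫ θ, (W (z * circleMap 1 r θ) + logShift r θ) ^ 2 ∂angleMeasure := by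
      refine integral_mono ((i12.const_mul _).sub (integrable_const _)) i3 fun θ => ?_
      simp only
      nlinarith [sq_nonneg (W (z * circleMap 1 r θ) + logShift r θ - W z)]
    rw [integral_sub (i12.const_mul _) (integrable_const _), integral_const_mul,
      integral_add i1 i2, hA, integral_logShift hr0 hr1, integral_const] at h1
    simp only [probReal_univ, one_smul] at h1
    have := hW z hz
    nlinarith
  -- Averaging over `‖z‖ = exp t` and exchanging the averages gives radial means at `t + log ‖m‖`.
  set F : ℝ → ℝ → ℝ := fun φ θ =>
    (W (circleMap 0 (Real.exp t) φ * circleMap 1 r θ) + logShift r θ) ^ 2 with hF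
  have hFm : Measurable (Function.uncurry F) := by
    have h1 : Continuous fun p : ℝ × ℝ => circleMap 0 (Real.exp t) p.1 * circleMap 1 r p.2 := by
      unfold circleMap; fun_prop
    exact ((hWm.comp h1.measurable).add (hxc.measurable.comp measurable_snd)).pow_const 2
  have hbt : ∀ φ θ, |W (circleMap 0 (Real.exp t) φ * circleMap 1 r θ)| ≤ c + (|t| + δ) := by
    intro φ θ
    have := hbound _ (circleMap_exp_ne_zero t φ) θ
    rwa [norm_circleMap_exp, Real.log_exp] at this
  have hFi : Integrable (Function.uncurry F) (angleMeasure.prod angleMeasure) := by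
    refine Integrable.of_bound hFm.aestronglyMeasurable
      ((c + (|t| + δ) + δ) ^ 2) (Eventually.of_forall fun p => ?_)
    simp only [Function.uncurry, hF]
    rw [norm_pow]
    refine pow_le_pow_left₀ (norm_nonneg _) ?_ 2
    exact (norm_add_le _ _).trans (add_le_add (hbt _ _) (hxδ _))
  have hWt : ∀ φ, |W (circleMap 0 (Real.exp t) φ)| ≤ c + |t| := by
    intro φ
    have := hWb _ (circleMap_exp_ne_zero t φ)
    rwa [norm_circleMap_exp, Real.log_exp] at this
  calc radialMean (fun z => W z ^ 2) t
      = ∫ φ, W (circleMap 0 (Real.exp t) φ) ^ 2 ∂angleMeasure :=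
        circleAverage_eq_integral_angleMeasure _ _ _
    _ ≤ ∫ φ, (∫ θ, F φ θ ∂angleMeasure) ∂angleMeasure := by
        refine integral_mono ?_ hFi.integral_prod_left fun φ => hpt _ (circleMap_exp_ne_zero t φ)
        refine integrable_comp_circleMap (g := fun z => W z ^ 2) (hWm.pow_const 2)
          (B := (c + |t|) ^ 2) fun φ => ?_
        rw [abs_pow]
        exact pow_le_pow_left₀ (abs_nonneg _) (hWt φ) 2
    _ = ∫ θ, (∫ φ, F φ θ ∂angleMeasure) ∂angleMeasure := integral_integral_swap hFi
    _ = _ := by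
        refine integral_congr_ae (Eventually.of_forall fun θ => ?_)
        have hmul : Measurable fun z : ℂ => W (z * circleMap 1 r θ) :=
          hWm.comp (measurable_mul_const _)
        have i1 : Integrable (fun φ => W (circleMap 0 (Real.exp t) φ * circleMap 1 r θ)) angleMeasure :=
          integrable_comp_circleMap hmul fun φ => hbt φ θ
        have i2 : Integrable (fun φ => W (circleMap 0 (Real.exp t) φ * circleMap 1 r θ) ^ 2)
            angleMeasure :=
          integrable_comp_circleMap (g := fun z => W (z * circleMap 1 r θ) ^ 2) (hmul.pow_const 2)
            (B := (c + (|t| + δ)) ^ 2) fun φ => by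
              rw [abs_pow]; exact pow_le_pow_left₀ (abs_nonneg _) (hbt φ θ) 2
        have e1 : ∫ φ, W (circleMap 0 (Real.exp t) φ * circleMap 1 r θ) ∂angleMeasure =
            radialMean W (t + logShift r θ) := by
          rw [logShift, ← radialMean_comp_mul W (hm0 θ)]
          exact (circleAverage_eq_integral_angleMeasure
            (fun z => W (z * circleMap 1 r θ)) 0 (Real.exp t)).symm
        have e2 : ∫ φ, W (circleMap 0 (Real.exp t) φ * circleMap 1 r θ) ^ 2 ∂angleMeasure =
            radialMean (fun z => W z ^ 2) (t + logShift r θ) := by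
          rw [logShift, ← radialMean_comp_mul (fun z => W z ^ 2) (hm0 θ)]
          exact (circleAverage_eq_integral_angleMeasure
            (fun z => W (z * circleMap 1 r θ) ^ 2) 0 (Real.exp t)).symm
        have e3 : ∀ φ, F φ θ = W (circleMap 0 (Real.exp t) φ * circleMap 1 r θ) ^ 2 +
            2 * logShift r θ * W (circleMap 0 (Real.exp t) φ * circleMap 1 r θ) +
              logShift r θ ^ 2 := fun φ => by simp only [hF]; ring
        have i3 : Integrable (fun φ => W (circleMap 0 (Real.exp t) φ * circleMap 1 r θ) ^ 2 +
            2 * logShift r θ * W (circleMap 0 (Real.exp t) φ * circleMap 1 r θ)) angleMeasure :=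
          i2.add (i1.const_mul _)
        simp_rw [e3]
        rw [integral_add i3 (integrable_const _), integral_add i2 (i1.const_mul _),
          integral_const_mul, e1, e2, integral_const]
        simp

/-! ### The energy estimate for two minorants with disjoint supports -/

namespace PuncturedMinorant

variable {f : ℂ → ℝ} {K : Set ℂ} {c : ℝ}

lemma abs_le_of_bounds (hf : PuncturedMinorant f K) (hc : 0 ≤ c)
    (hu : ∀ z, z ≠ 0 → f z ≤ max 0 (c - Real.log ‖z‖)) {z : ℂ} (hz : z ≠ 0) :
    |f z| ≤ c + |Real.log ‖z‖| := by
  rw [abs_of_nonneg (hf.nonneg z)]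
  refine (hu z hz).trans (max_le (by positivity) ?_)
  linarith [neg_abs_le (Real.log ‖z‖)]

lemma locallyBdd_radialMean (hf : PuncturedMinorant f K) (hc : 0 ≤ c)
    (hu : ∀ z, z ≠ 0 → f z ≤ max 0 (c - Real.log ‖z‖)) : LocallyBdd (radialMean f) := by
  intro T
  refine ⟨c + T, fun t ht => (abs_radialMean_le (B := c + |t|) fun z hz => ?_).trans (by linarith)⟩
  have := hf.abs_le_of_bounds hc hu (norm_pos_iff.1 (hz ▸ Real.exp_pos t))
  rwa [hz, Real.log_exp] at this

lemma radialMean_add_mono (hf : PuncturedMinorant f K) : Monotone fun t => radialMean f t + t := by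
  intro s t hst
  have := hf.circleAverage_add_log_mono (Real.exp_pos s) (Real.exp_le_exp.2 hst)
  simpa [radialMean, Real.log_exp] using this

lemma radialMean_le (hf : PuncturedMinorant f K)
    (hu : ∀ z, z ≠ 0 → f z ≤ max 0 (c - Real.log ‖z‖)) (t : ℝ) :
    radialMean f t ≤ max 0 (c - t) := by
  refine (le_abs_self _).trans (abs_radialMean_le fun z hz => ?_)
  have := hu z (norm_pos_iff.1 (hz ▸ Real.exp_pos t))
  rw [hz, Real.log_exp] at this
  rwa [abs_of_nonneg (hf.nonneg z)]

lemma le_radialMean_add (hf : PuncturedMinorant f K) (hc : 0 ≤ c)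
    (hu : ∀ z, z ≠ 0 → f z ≤ max 0 (c - Real.log ‖z‖))
    (hl : ∀ z, z ≠ 0 → -c ≤ f z + Real.log ‖z‖) (t : ℝ) : -c ≤ radialMean f t + t := by
  have h : radialMean (fun _ => -c - t) t ≤ radialMean f t := by
    refine radialMean_mono measurable_const hf.measurable (B := c + |t|)
      (fun z _ => ?_) (fun z hz => ?_) (fun z hz => ?_)
    · rw [abs_le]; constructor <;> linarith [neg_abs_le t, le_abs_self t]
    · have := hf.abs_le_of_bounds hc hu (norm_pos_iff.1 (hz ▸ Real.exp_pos t))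
      rwa [hz, Real.log_exp] at this
    · have := hl z (norm_pos_iff.1 (hz ▸ Real.exp_pos t))
      rw [hz, Real.log_exp] at this
      linarith
  rw [radialMean, circleAverage_const] at h
  linarith

/-- Lower bound for the integral of the radial mean over the side of the pole. -/
lemma le_integral_radialMean (hf : PuncturedMinorant f K) (hc : 1 ≤ c)
    (hu : ∀ z, z ≠ 0 → f z ≤ max 0 (c - Real.log ‖z‖))
    (hl : ∀ z, z ≠ 0 → -c ≤ f z + Real.log ‖z‖) {N y : ℝ} (hN : c + 1 < N) (hy : |y| ≤ 1 / N) :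
    N ^ 2 / 2 + N * (radialMean f (-N + 1) + (-N + 1)) - 1 - 4 * c ≤
      ∫ t in (y - N)..y, radialMean f t := by
  have hN0 : 0 < N := by linarith
  have hc0 : 0 ≤ c := by linarith
  have hyN : |y| * N ≤ 1 := by rwa [le_div_iff₀ hN0] at hy
  have hy1 : |y| ≤ 1 := hy.trans (by rw [div_le_one hN0]; linarith)
  have hy' := abs_le.1 hy1
  set b := radialMean f (-N + 1) + (-N + 1) with hb
  have hbu : b ≤ c := by
    have := hf.radialMean_le hu (-N + 1)
    rw [max_eq_right (by linarith)] at this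
    linarith
  have hbl : -c ≤ b := hf.le_radialMean_add hc0 hu hl _
  have hi := (hf.locallyBdd_radialMean hc0 hu).intervalIntegrable
    (measurable_radialMean hf.measurable)
  rw [← intervalIntegral.integral_add_adjacent_intervals (hi (y - N) (-N + 1)) (hi (-N + 1) y)]
  have h1 : ∫ t in (y - N)..(-N + 1), (-c - t) ≤ ∫ t in (y - N)..(-N + 1), radialMean f t := by
    refine intervalIntegral.integral_mono_on (by linarith)
      (Continuous.intervalIntegrable (by fun_prop) _ _) (hi _ _) fun t _ => ?_
    linarith [hf.le_radialMean_add hc0 hu hl t]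
  have h2 : ∫ t in (-N + 1)..y, (b - t) ≤ ∫ t in (-N + 1)..y, radialMean f t := by
    refine intervalIntegral.integral_mono_on (by linarith)
      (Continuous.intervalIntegrable (by fun_prop) _ _) (hi _ _) fun t ht => ?_
    have : b ≤ radialMean f t + t := hf.radialMean_add_mono ht.1
    linarith
  rw [intervalIntegral.integral_sub intervalIntegrable_const intervalIntegral.intervalIntegrable_id,
    intervalIntegral.integral_const, integral_id, smul_eq_mul] at h1 h2
  have h3 : y * N ≤ 1 := (mul_le_mul_of_nonneg_right (le_abs_self y) hN0.le).trans hyN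
  nlinarith

/-- Upper bound for the integral of the radial mean over the side away from the pole. -/
lemma integral_radialMean_neg_le (hf : PuncturedMinorant f K) (hc : 1 ≤ c)
    (hu : ∀ z, z ≠ 0 → f z ≤ max 0 (c - Real.log ‖z‖)) {N y : ℝ} (hN : c + 1 < N)
    (hy : |y| ≤ 1 / N) :
    ∫ t in (y - N)..y, radialMean f (-t) ≤ (c + 1) ^ 2 := by
  have hN0 : 0 < N := by linarith
  have hc0 : 0 ≤ c := by linarith
  have hy1 : |y| ≤ 1 := hy.trans (by rw [div_le_one hN0]; linarith)
  have hy' := abs_le.1 hy1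
  have hb : LocallyBdd fun t => radialMean f (-t) := by
    intro T
    obtain ⟨B, hB⟩ := hf.locallyBdd_radialMean hc0 hu T
    exact ⟨B, fun t ht => hB _ (by rwa [abs_neg])⟩
  have hi := hb.intervalIntegrable ((measurable_radialMean hf.measurable).comp measurable_neg)
  rw [← intervalIntegral.integral_add_adjacent_intervals (hi (y - N) (-c)) (hi (-c) y)]
  have h1 : ∫ t in (y - N)..(-c), radialMean f (-t) ≤ ∫ t in (y - N)..(-c), (0 : ℝ) := by
    refine intervalIntegral.integral_mono_on (by linarith) (hi _ _) intervalIntegrable_const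
      fun t ht => ?_
    have := hf.radialMean_le hu (-t)
    rwa [max_eq_left (by linarith [ht.2])] at this
  have h2 : ∫ t in (-c)..y, radialMean f (-t) ≤ ∫ t in (-c)..y, (c + 1) := by
    refine intervalIntegral.integral_mono_on (by linarith) (hi _ _) intervalIntegrable_const
      fun t ht => ?_
    refine (hf.radialMean_le hu (-t)).trans (max_le (by linarith) (by linarith [ht.2]))
  rw [intervalIntegral.integral_const, smul_eq_mul] at h1 h2
  nlinarith

/-- The mean of the square near the pole, up to a bounded error: `W = -t + u` on the circle, where
`|u| ≤ c`, so that `W² = t² - 2 t u + O(1)`. The window `|t + N| ≤ 1 / N` is narrow enough for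
`t² = N² + O(1)`. -/
lemma radialMean_sq_bound (hf : PuncturedMinorant f K) (hc : 1 ≤ c)
    (hu : ∀ z, z ≠ 0 → f z ≤ max 0 (c - Real.log ‖z‖))
    (hl : ∀ z, z ≠ 0 → -c ≤ f z + Real.log ‖z‖) {N t : ℝ} (hN : c + 1 < N)
    (ht : |t + N| ≤ 1 / N) {W : ℂ → ℝ} (hW : ∀ z, ‖z‖ = Real.exp t → W z = f z) :
    radialMean (fun z => W z ^ 2) t ≤
      N ^ 2 + 2 * N * (radialMean f (-N + 1) + (-N + 1)) + (c ^ 2 + 2 * c + 3) := by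
  have hN0 : 0 < N := by linarith
  have hc0 : 0 ≤ c := by linarith
  have htN : |t + N| * N ≤ 1 := by rwa [le_div_iff₀ hN0] at ht
  have ht1 : |t + N| ≤ 1 := ht.trans (by rw [div_le_one hN0]; linarith)
  have ht' := abs_le.1 ht1
  have htlt : t < -c := by linarith
  set b := radialMean f (-N + 1) + (-N + 1) with hb
  have hbu : b ≤ c := by
    have := hf.radialMean_le hu (-N + 1)
    rw [max_eq_right (by linarith)] at this
    linarith
  have hbl : -c ≤ b := hf.le_radialMean_add hc0 hu hl _
  have h0 : radialMean (fun z => W z ^ 2) t = radialMean (fun z => f z ^ 2) t := by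
    refine circleAverage_congr_sphere fun z hz => ?_
    have : ‖z‖ = Real.exp t := by simpa using hz
    simp only [hW z this]
  have hfb : ∀ z : ℂ, ‖z‖ = Real.exp t → |f z| ≤ c + |t| := fun z hz => by
    have := hf.abs_le_of_bounds hc0 hu (norm_pos_iff.1 (hz ▸ Real.exp_pos t))
    rwa [hz, Real.log_exp] at this
  have h1 : radialMean (fun z => f z ^ 2) t ≤
      radialMean (fun z => (-2 * t) * f z + (c ^ 2 - t ^ 2)) t := by
    refine radialMean_mono (hf.measurable.pow_const 2) ((hf.measurable.const_mul _).add_const _)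
      (B := (c + |t|) ^ 2 + (2 * |t| * (c + |t|) + |c ^ 2 - t ^ 2|)) (fun z hz => ?_) (fun z hz => ?_) fun z hz => ?_
    · rw [abs_pow]
      have := pow_le_pow_left₀ (abs_nonneg _) (hfb z hz) 2
      have : 0 ≤ 2 * |t| * (c + |t|) + |c ^ 2 - t ^ 2| := by positivity
      linarith
    · refine (abs_add_le _ _).trans ?_
      rw [abs_mul, abs_mul, abs_neg, abs_two]
      have := mul_le_mul_of_nonneg_left (hfb z hz) (show 0 ≤ 2 * |t| by positivity)
      have : 0 ≤ (c + |t|) ^ 2 := by positivity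
      linarith
    · have hz0 : z ≠ 0 := norm_pos_iff.1 (hz ▸ Real.exp_pos t)
      have e1 := hu z hz0
      have e2 := hl z hz0
      rw [hz, Real.log_exp] at e1 e2
      rw [max_eq_right (by linarith)] at e1
      nlinarith
  have hfi : CircleIntegrable f 0 (Real.exp t) := hf.circleIntegrable (by simp)
  have hcm : CircleIntegrable (fun z => (-2 * t) * f z) 0 (Real.exp t) := hfi.const_smul (a := -2 * t)
  have h2 : radialMean (fun z => (-2 * t) * f z + (c ^ 2 - t ^ 2)) t =
      (-2 * t) * radialMean f t + (c ^ 2 - t ^ 2) := by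
    rw [radialMean, circleAverage_fun_add hcm (circleIntegrable_const _ _ _), circleAverage_const]
    congr 1
    exact circleAverage_fun_smul (a := -2 * t)
  rw [h0]
  refine h1.trans ?_
  rw [h2]
  have h3 : radialMean f t + t ≤ b := hf.radialMean_add_mono (by linarith)
  have h4 : (-2 * t) * (radialMean f t + t) ≤ (-2 * t) * b :=
    mul_le_mul_of_nonneg_left h3 (by linarith)
  set s := t + N with hs
  have hts : t = s - N := by rw [hs]; ring
  have h5 : s * N ≤ 1 := (mul_le_mul_of_nonneg_right (le_abs_self s) hN0.le).trans htN
  have h6 : -1 ≤ s * N := by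
    have := mul_le_mul_of_nonneg_right (neg_abs_le s) hN0.le
    linarith
  have h7 : s ^ 2 ≤ 1 := by nlinarith
  have h8 : -(s * b) ≤ c := by
    have e1 : |s * b| ≤ 1 * c := by
      rw [abs_mul]; exact mul_le_mul ht1 (abs_le.2 ⟨hbl, hbu⟩) (abs_nonneg _) zero_le_one
    linarith [neg_abs_le (s * b)]
  have e : (-2 * t) * radialMean f t + (c ^ 2 - t ^ 2) =
    (-2 * t) * (radialMean f t + t) + t ^ 2 + c ^ 2 := by ring
  rw [e]
  have e2 : (-2 * t) * b = 2 * N * b - 2 * (s * b) := by rw [hts]; ring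
  have e3 : t ^ 2 = s ^ 2 - 2 * (s * N) + N ^ 2 := by rw [hts]; ring
  rw [e2] at h4
  rw [e3]
  linarith

end PuncturedMinorant

/-- The energy estimate: `f₁` with pole at `0` and `z ↦ f₂ z⁻¹` with pole at `∞` have disjoint
supports in the strong sense that `W = f₁ - f₂ ∘ (·)⁻¹` moves away from `0` under averaging over
small circles. Then the sum of the means of `f₁ + log ‖z‖` and `f₂ + log ‖z‖` over the circle of
radius `exp (1 - N)` is `O(1 / N)`, with a constant that depends only on the a priori bound `c`. -/
theorem mul_radialMean_add_le {f₁ f₂ : ℂ → ℝ} {K₁ K₂ : Set ℂ} (h₁ : PuncturedMinorant f₁ K₁)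
    (h₂ : PuncturedMinorant f₂ K₂) {c : ℝ} (hc : 1 ≤ c)
    (hu₁ : ∀ z, z ≠ 0 → f₁ z ≤ max 0 (c - Real.log ‖z‖))
    (hl₁ : ∀ z, z ≠ 0 → -c ≤ f₁ z + Real.log ‖z‖)
    (hu₂ : ∀ z, z ≠ 0 → f₂ z ≤ max 0 (c - Real.log ‖z‖))
    (hl₂ : ∀ z, z ≠ 0 → -c ≤ f₂ z + Real.log ‖z‖)
    (hW : ∃ δ > 0, ∀ r, 0 < r → r ≤ δ → ∀ z, z ≠ 0 → (f₁ z - f₂ z⁻¹) * (f₁ z - f₂ z⁻¹) ≤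
      (f₁ z - f₂ z⁻¹) * circleAverage (fun z => f₁ z - f₂ z⁻¹) z (r * ‖z‖))
    {N : ℝ} (hN : c + 1 < N) :
    N * ((radialMean f₁ (-N + 1) + (-N + 1)) + (radialMean f₂ (-N + 1) + (-N + 1))) ≤
      (c ^ 2 + 2 * c + 3) + 4 * (1 + 4 * c + (c + 1) ^ 2) := by
  have hN0 : 0 < N := by linarith
  have hc0 : 0 ≤ c := by linarith
  obtain ⟨δ, hδ, hW⟩ := hW
  -- The shifts `log ‖1 + r e^{iθ}‖` must not exceed `1 / N`, see `radialMean_sq_bound`.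
  obtain ⟨r, hr0, hrδ, hr1, hrN⟩ : ∃ r, 0 < r ∧ r ≤ δ ∧ r < 1 ∧ -Real.log (1 - r) ≤ 1 / N := by
    refine ⟨min δ (1 - Real.exp (-(1 / N))), ?_, min_le_left _ _, ?_, ?_⟩
    · refine lt_min hδ (sub_pos.2 (Real.exp_lt_one_iff.2 ?_))
      have : 0 < 1 / N := by positivity
      linarith
    · have := Real.exp_pos (-(1 / N))
      exact (min_le_right _ _).trans_lt (by linarith)
    · have h1 : Real.exp (-(1 / N)) ≤ 1 - min δ (1 - Real.exp (-(1 / N))) := by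
        linarith [min_le_right δ (1 - Real.exp (-(1 / N)))]
      have := Real.log_le_log (Real.exp_pos _) h1
      rw [Real.log_exp] at this
      linarith
  set W : ℂ → ℝ := fun z => f₁ z - f₂ z⁻¹ with hWdef
  have hinvm : Measurable fun z : ℂ => f₂ z⁻¹ := h₂.measurable.comp measurable_inv
  have hWm : Measurable W := h₁.measurable.sub hinvm
  have hWb : ∀ z, z ≠ 0 → |W z| ≤ c + |Real.log ‖z‖| := by
    intro z hz
    have b1 := h₁.abs_le_of_bounds hc0 hu₁ hz
    have b2 := h₂.abs_le_of_bounds hc0 hu₂ (inv_ne_zero hz)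
    rw [norm_inv, Real.log_inv, abs_neg] at b2
    rw [abs_of_nonneg (h₁.nonneg _)] at b1
    rw [abs_of_nonneg (h₂.nonneg _)] at b2
    have := h₁.nonneg z
    have := h₂.nonneg z⁻¹
    rw [abs_le]; constructor <;> simp only [hWdef] <;> linarith
  have hWt : ∀ t, ∀ z : ℂ, ‖z‖ = Real.exp t → |W z| ≤ c + |t| := fun t z hz => by
    have := hWb z (norm_pos_iff.1 (hz ▸ Real.exp_pos t))
    rwa [hz, Real.log_exp] at this
  have hIb : LocallyBdd (radialMean W) := fun T =>
    ⟨c + T, fun t ht => (abs_radialMean_le (hWt t)).trans (by linarith)⟩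
  have hJb : LocallyBdd (radialMean fun z => W z ^ 2) := fun T =>
    ⟨(c + T) ^ 2, fun t ht => abs_radialMean_le fun z hz => by
      rw [abs_pow]
      exact pow_le_pow_left₀ (abs_nonneg _) ((hWt t z hz).trans (by linarith)) 2⟩
  have hsplit : ∀ t, radialMean W t = radialMean f₁ t - radialMean f₂ (-t) := by
    intro t
    rw [← radialMean_comp_inv]
    have i1 : CircleIntegrable f₁ 0 (Real.exp t) := h₁.circleIntegrable (by simp)
    refine circleAverage_fun_sub i1 (circleIntegrable_of_bounded (C := c + |t|) hinvm fun z hz => ?_)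
    have hz' : ‖z‖ = Real.exp t := by simpa using hz
    have := h₂.abs_le_of_bounds hc0 hu₂ (inv_ne_zero (norm_pos_iff.1 (hz' ▸ Real.exp_pos t)))
    rwa [norm_inv, Real.log_inv, abs_neg, hz', Real.log_exp] at this
  have hi₁ := (h₁.locallyBdd_radialMean hc0 hu₁).intervalIntegrable
    (measurable_radialMean h₁.measurable)
  have hi₂ := (h₂.locallyBdd_radialMean hc0 hu₂).intervalIntegrable
    (measurable_radialMean h₂.measurable)
  have hneg : ∀ {g : ℝ → ℝ}, (∀ a b, IntervalIntegrable g volume a b) →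
      ∀ a b, IntervalIntegrable (fun t => g (-t)) volume a b := fun {g} hg a b => by
    have := (hg (-a) (-b)).comp_sub_left 0
    simpa using this
  set b₁ := radialMean f₁ (-N + 1) + (-N + 1) with hb₁
  set b₂ := radialMean f₂ (-N + 1) + (-N + 1) with hb₂
  have key := two_mul_le_of_shift_inequality (ν := angleMeasure) (x := logShift r)
    (continuous_logShift hr0 hr1).measurable (δ := 1 / N)
    (fun θ => (abs_logShift_le hr0 hr1 θ).trans hrN) (integral_logShift hr0 hr1)
    (integral_logShift_sq_pos hr0 hr1) (J := radialMean fun z => W z ^ 2) (I := radialMean W)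
    (measurable_radialMean (hWm.pow_const 2)) (measurable_radialMean hWm) hJb hIb
    (fun t => circleAverage_nonneg_of_nonneg fun z _ => sq_nonneg _)
    (radialMean_sq_le hWm hWb hr0 hr1 (hW r hr0 hrδ)) hN0
    (S₁ := N ^ 2 + 2 * N * b₁ + (c ^ 2 + 2 * c + 3))
    (S₂ := N ^ 2 + 2 * N * b₂ + (c ^ 2 + 2 * c + 3))
    (L := (N ^ 2 / 2 + N * b₁ - 1 - 4 * c - (c + 1) ^ 2) +
      (N ^ 2 / 2 + N * b₂ - 1 - 4 * c - (c + 1) ^ 2)) ?_ ?_ ?_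
  · linarith
  · intro t ht
    refine h₁.radialMean_sq_bound hc hu₁ hl₁ hN ht fun z hz => ?_
    have ht1 : |t + N| ≤ 1 := ht.trans (by rw [div_le_one hN0]; linarith)
    have ht' := abs_le.1 ht1
    have := hu₂ z⁻¹ (inv_ne_zero (norm_pos_iff.1 (hz ▸ Real.exp_pos t)))
    rw [norm_inv, Real.log_inv, hz, Real.log_exp, max_eq_left (by linarith)] at this
    simp only [hWdef]
    linarith [h₂.nonneg z⁻¹]
  · intro t ht
    have ht1 : |t - N| ≤ 1 := ht.trans (by rw [div_le_one hN0]; linarith)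
    have ht' := abs_le.1 ht1
    have h0 : radialMean (fun z => W z ^ 2) t = radialMean (fun z => (-W z⁻¹) ^ 2) (-t) := by
      rw [← radialMean_comp_inv]
      simp
    rw [h0]
    refine h₂.radialMean_sq_bound hc hu₂ hl₂ hN
      (by rw [← abs_neg]; convert ht using 2; ring) fun z hz => ?_
    have := hu₁ z⁻¹ (inv_ne_zero (norm_pos_iff.1 (hz ▸ Real.exp_pos _)))
    rw [norm_inv, Real.log_inv, hz, Real.log_exp, max_eq_left (by linarith)] at this
    simp only [hWdef, inv_inv]
    linarith [h₁.nonneg z⁻¹]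
  · intro y hy
    have hy2 : |-y| ≤ 1 / N := by rwa [abs_neg]
    have e1 : ∫ t in (y - N)..y, radialMean W t =
        (∫ t in (y - N)..y, radialMean f₁ t) - ∫ t in (y - N)..y, radialMean f₂ (-t) := by
      simp_rw [hsplit]
      exact intervalIntegral.integral_sub (hi₁ _ _) (hneg hi₂ _ _)
    have e2 : ∫ t in y..(y + N), radialMean W t =
        (∫ t in (-y - N)..(-y), radialMean f₁ (-t)) - ∫ t in (-y - N)..(-y), radialMean f₂ t := by
      simp_rw [hsplit]
      rw [intervalIntegral.integral_sub (hi₁ _ _) (hneg hi₂ _ _), intervalIntegral.integral_comp_neg,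
        intervalIntegral.integral_comp_neg]
      simp [sub_eq_add_neg, add_comm]
    rw [e1, e2]
    have k1 := h₁.le_integral_radialMean hc hu₁ hl₁ hN hy
    have k2 := h₂.le_integral_radialMean hc hu₂ hl₂ hN hy2
    have k3 := h₂.integral_radialMean_neg_le hc hu₂ hN hy
    have k4 := h₁.integral_radialMean_neg_le hc hu₁ hN hy2
    linarith

/-! ### Points near the poles -/

lemma exists_harnack_radius (C m : ℝ) {R η : ℝ} (hR : 0 < R) (hη : 0 < η) :
    ∃ ρ > 0, ρ < R ∧ ∀ s, 0 ≤ s → s < ρ → m - η ≤ C - (C - m) * ((R + s) / (R - s)) := by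
  have hc : ContinuousAt (fun s => C - (C - m) * ((R + s) / (R - s))) 0 := by
    have : R - 0 ≠ 0 := by simpa using hR.ne'
    fun_prop (disch := assumption)
  have h0 : C - (C - m) * ((R + 0) / (R - 0)) = m := by
    rw [add_zero, sub_zero, div_self hR.ne']; ring
  have h := hc.eventually (lt_mem_nhds (show m - η < C - (C - m) * ((R + 0) / (R - 0)) by
    rw [h0]; linarith))
  obtain ⟨ρ, hρ, h⟩ := Metric.eventually_nhds_iff.1 h
  refine ⟨min ρ (R / 2), by positivity, (min_le_right _ _).trans_lt (by linarith), ?_⟩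
  intro s hs hsρ
  exact (h (by simpa [abs_of_nonneg hs] using hsρ.trans_le (min_le_left _ _))).le

/-- If minorants with poles at `0` and `∞` as in `mul_radialMean_add_le`, with uniform bounds,
attain the values `m₁` and `m₂` of `f + log ‖z‖` at points arbitrarily close to their poles,
then `m₁ + m₂ ≤ 0`. -/
theorem add_nonpos_of_minorants {c m₁ m₂ : ℝ} (hc : 1 ≤ c)
    (H : ∀ ρ > 0, ∃ (f₁ f₂ : ℂ → ℝ) (K₁ K₂ : Set ℂ) (ζ₁ ζ₂ : ℂ),
      PuncturedMinorant f₁ K₁ ∧ PuncturedMinorant f₂ K₂ ∧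
      (∀ z, z ≠ 0 → f₁ z ≤ max 0 (c - Real.log ‖z‖)) ∧
      (∀ z, z ≠ 0 → -c ≤ f₁ z + Real.log ‖z‖) ∧
      (∀ z, z ≠ 0 → f₂ z ≤ max 0 (c - Real.log ‖z‖)) ∧
      (∀ z, z ≠ 0 → -c ≤ f₂ z + Real.log ‖z‖) ∧
      (∃ δ > 0, ∀ r, 0 < r → r ≤ δ → ∀ z, z ≠ 0 → (f₁ z - f₂ z⁻¹) * (f₁ z - f₂ z⁻¹) ≤
        (f₁ z - f₂ z⁻¹) * circleAverage (fun z => f₁ z - f₂ z⁻¹) z (r * ‖z‖)) ∧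
      ζ₁ ≠ 0 ∧ ‖ζ₁‖ < ρ ∧ m₁ ≤ f₁ ζ₁ + Real.log ‖ζ₁‖ ∧
      ζ₂ ≠ 0 ∧ ‖ζ₂‖ < ρ ∧ m₂ ≤ f₂ ζ₂ + Real.log ‖ζ₂‖) : m₁ + m₂ ≤ 0 := by
  by_contra! hm
  set A := (c ^ 2 + 2 * c + 3) + 4 * (1 + 4 * c + (c + 1) ^ 2) with hA
  set η := (m₁ + m₂) / 4 with hη
  have hη0 : 0 < η := by positivity
  obtain ⟨N, hN1, hN2⟩ : ∃ N, c + 1 < N ∧ A < N * (2 * η) := by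
    refine ⟨max (c + 2) (A / (2 * η) + 1), ?_, ?_⟩
    · exact lt_of_lt_of_le (by linarith) (le_max_left _ _)
    · rw [← div_lt_iff₀ (by positivity)]
      exact lt_of_lt_of_le (by linarith) (le_max_right _ _)
  obtain ⟨ρ₁, hρ₁, hρ₁R, hρ₁h⟩ := exists_harnack_radius c m₁ (Real.exp_pos (-N + 1)) hη0
  obtain ⟨ρ₂, hρ₂, hρ₂R, hρ₂h⟩ := exists_harnack_radius c m₂ (Real.exp_pos (-N + 1)) hη0
  obtain ⟨f₁, f₂, K₁, K₂, ζ₁, ζ₂, h₁, h₂, hu₁, hl₁, hu₂, hl₂, hW, hζ₁, hζ₁ρ, hm₁, hζ₂, hζ₂ρ, hm₂⟩ :=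
    H (min ρ₁ ρ₂) (lt_min hρ₁ hρ₂)
  have hmain := mul_radialMean_add_le h₁ h₂ hc hu₁ hl₁ hu₂ hl₂ hW hN1
  have hbd : ∀ {f : ℂ → ℝ}, (∀ z, z ≠ 0 → f z ≤ max 0 (c - Real.log ‖z‖)) →
      ∀ z, ‖z‖ = Real.exp (-N + 1) → f z + Real.log (Real.exp (-N + 1)) ≤ c := by
    intro f hf z hz
    have := hf z (norm_pos_iff.1 (hz ▸ Real.exp_pos _))
    rw [hz, Real.log_exp, max_eq_right (by linarith)] at this
    rw [Real.log_exp]; linarith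
  have hζ₁ρ' := hζ₁ρ.trans_le (min_le_left _ _)
  have hζ₂ρ' := hζ₂ρ.trans_le (min_le_right _ _)
  have b₁ := h₁.harnack (hbd hu₁) hζ₁ (hζ₁ρ'.trans hρ₁R) hm₁
  have b₂ := h₂.harnack (hbd hu₂) hζ₂ (hζ₂ρ'.trans hρ₂R) hm₂
  have c₁ := hρ₁h ‖ζ₁‖ (norm_nonneg _) hζ₁ρ'
  have c₂ := hρ₂h ‖ζ₂‖ (norm_nonneg _) hζ₂ρ'
  rw [Real.log_exp] at b₁ b₂
  change _ ≤ radialMean f₁ (-N + 1) + _ at b₁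
  change _ ≤ radialMean f₂ (-N + 1) + _ at b₂
  have : N * (2 * η) ≤
      N * ((radialMean f₁ (-N + 1) + (-N + 1)) + (radialMean f₂ (-N + 1) + (-N + 1))) := by
    refine mul_le_mul_of_nonneg_left ?_ (by linarith)
    have : 4 * η = m₁ + m₂ := by rw [hη]; ring
    linarith
  linarith

/-! ### The charts of the sphere and the Green functions of discs -/

lemma invChart_zero : invChart 0 = OnePoint.infty := if_pos rfl

lemma invChart_of_ne {w : ℂ} (hw : w ≠ 0) : invChart w = ((w⁻¹ : ℂ) : Sphere) := if_neg hw

lemma invChart_inv {z : ℂ} (hz : z ≠ 0) : invChart z⁻¹ = (z : Sphere) := by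
  rw [invChart_of_ne (inv_ne_zero hz), inv_inv]

lemma continuous_invChart : Continuous invChart := by
  rw [continuous_iff_continuousAt]
  intro w
  by_cases hw : w = 0
  · subst hw
    rw [← continuousWithinAt_compl_self, ContinuousWithinAt, invChart_zero]
    have h1 : Tendsto (fun w : ℂ => ((w⁻¹ : ℂ) : Sphere)) (𝓝[≠] 0) (𝓝 OnePoint.infty) := by
      have h2 := OnePoint.tendsto_coe_infty (X := ℂ)
      rw [coclosedCompact_eq_cocompact, ← Metric.cobounded_eq_cocompact] at h2
      exact h2.comp tendsto_inv₀_nhdsNE_zero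
    refine h1.congr' ?_
    filter_upwards [self_mem_nhdsWithin] with w hw
    exact (invChart_of_ne hw).symm
  · have h1 : ContinuousAt (fun w : ℂ => ((w⁻¹ : ℂ) : Sphere)) w :=
      OnePoint.continuous_coe.continuousAt.comp (continuousAt_inv₀ hw)
    refine h1.congr ?_
    filter_upwards [isOpen_ne.mem_nhds hw] with w' hw'
    exact (invChart_of_ne hw').symm

lemma localParam_zero (ζ : ℂ) : localParam ((0 : ℂ) : Sphere) ζ = (ζ : Sphere) := by
  change (((0 + ζ : ℂ)) : Sphere) = _
  rw [zero_add]

lemma localParam_infty (ζ : ℂ) : localParam OnePoint.infty ζ = invChart ζ := rfl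

lemma preimage_coe_diff_zero (B : Set Sphere) :
    (fun z : ℂ => (z : Sphere)) ⁻¹' (B \ {((0 : ℂ) : Sphere)}) =
      ((fun z : ℂ => (z : Sphere)) ⁻¹' B) \ {0} := by
  ext z; simp

lemma preimage_coe_diff_infty (B : Set Sphere) :
    (fun z : ℂ => (z : Sphere)) ⁻¹' (B \ {OnePoint.infty}) = (fun z : ℂ => (z : Sphere)) ⁻¹' B := by
  ext z; simp

lemma preimage_invChart_diff_infty (B : Set Sphere) :
    invChart ⁻¹' (B \ {OnePoint.infty}) = (invChart ⁻¹' B) \ {0} := by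
  ext w
  by_cases hw : w = 0
  · simp [hw, invChart_zero]
  · simp [hw, invChart_of_ne]

lemma IsSubharmonicOn.sup {u v : ℂ → ℝ} {U : Set ℂ} (hu : IsSubharmonicOn u U)
    (hv : IsSubharmonicOn v U) : IsSubharmonicOn (fun z => max (u z) (v z)) U := by
  have hint : ∀ (z : ℂ) (r : ℝ), 0 < r → closedBall z r ⊆ U →
      CircleIntegrable (fun z => max (u z) (v z)) z r := by
    intro z r hr h
    have h1 := hu.circleIntegrable z r hr h
    have h2 := hv.circleIntegrable z r hr h
    exact ⟨h1.1.sup h2.1, h1.2.sup h2.2⟩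
  refine ⟨hu.usc.sup hv.usc, hint, fun z r hr h => max_le ?_ ?_⟩
  · exact (hu.le_circleAverage z r hr h).trans (circleAverage_mono (hu.circleIntegrable z r hr h)
      (hint z r hr h) fun _ _ => le_max_left _ _)
  · exact (hv.le_circleAverage z r hr h).trans (circleAverage_mono (hv.circleIntegrable z r hr h)
      (hint z r hr h) fun _ _ => le_max_right _ _)

lemma IsGreenMinorant.sup {B : Set Sphere} {a : Sphere} {v w : Sphere → ℝ}
    (hv : IsGreenMinorant B a v) (hw : IsGreenMinorant B a w) :
    IsGreenMinorant B a (fun z => max (v z) (w z)) := by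
  refine ⟨fun z => (hv.nonneg z).trans (le_max_left _ _),
    ⟨hv.subharmonic.1.sup hw.subharmonic.1, hv.subharmonic.2.sup hw.subharmonic.2⟩, ?_, ?_⟩
  · obtain ⟨K, hK, hKB, hv0⟩ := hv.compact_support
    obtain ⟨K', hK', hKB', hw0⟩ := hw.compact_support
    refine ⟨K ∪ K', hK.union hK', union_subset hKB hKB', fun z hz => ?_⟩
    rw [mem_union, not_or] at hz
    rw [hv0 z hz.1, hw0 z hz.2, max_self]
  · obtain ⟨M, hM⟩ := hv.log_pole
    obtain ⟨M', hM'⟩ := hw.log_pole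
    refine ⟨max M M', ?_⟩
    filter_upwards [hM, hM'] with ζ h1 h2
    rw [max_add]
    exact max_le_max h1 h2

lemma isSubharmonicOn_of_continuousOn {u : ℂ → ℝ} {U : Set ℂ} (hu : ContinuousOn u U)
    (h : ∀ (z : ℂ) (r : ℝ), 0 < r → closedBall z r ⊆ U → CircleIntegrable u z r →
      u z ≤ circleAverage u z r) : IsSubharmonicOn u U := by
  have hint : ∀ (z : ℂ) (r : ℝ), 0 < r → closedBall z r ⊆ U → CircleIntegrable u z r :=
    fun z r hr hz => (hu.mono (sphere_subset_closedBall.trans hz)).circleIntegrable hr.le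
  exact ⟨hu.upperSemicontinuousOn, hint, fun z r hr hz => h z r hr hz (hint z r hr hz)⟩

lemma circleAverage_posLog_nonneg (u : ℂ → ℝ) (z : ℂ) (r : ℝ) :
    0 ≤ circleAverage (fun z => Real.posLog (u z)) z r :=
  circleAverage_nonneg_of_nonneg fun _ _ => Real.posLog_nonneg

lemma posLog_norm_le_circleAverage (z : ℂ) {r : ℝ} (hr : 0 < r) :
    Real.posLog ‖z‖ ≤ circleAverage (fun z => Real.posLog ‖z‖) z r := by
  rcases eq_or_ne z 0 with rfl | hz
  · simpa using circleAverage_posLog_nonneg _ _ _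
  rw [Real.posLog_apply]
  refine max_le (circleAverage_posLog_nonneg _ _ _) ?_
  have i1 : CircleIntegrable (fun z : ℂ => Real.log ‖z‖) z r :=
    MeromorphicOn.circleIntegrable_log_norm (f := id) fun _ _ => MeromorphicAt.id _
  have i2 : CircleIntegrable (fun z : ℂ => Real.posLog ‖z‖) z r :=
    (Real.continuous_posLog.comp continuous_norm).continuousOn.circleIntegrable hr.le
  have h1 := circleAverage_log_norm_sub_const_eq_log_radius_add_posLog (c := z) (a := 0) hr.ne'
  simp only [sub_zero] at h1
  have h2 : Real.log ‖z‖ ≤ circleAverage (fun z : ℂ => Real.log ‖z‖) z r := by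
    rw [h1]
    have h3 : Real.log (r⁻¹ * ‖z‖) ≤ Real.posLog (r⁻¹ * ‖z‖) := le_max_right _ _
    rw [Real.log_mul (by positivity) (norm_ne_zero_iff.2 hz), Real.log_inv] at h3
    linarith
  exact h2.trans (circleAverage_mono i1 i2 fun w _ => le_max_right _ _)

lemma isSubharmonicOn_posLog_mul_norm {ρ : ℝ} (hρ : 0 < ρ) (U : Set ℂ) :
    IsSubharmonicOn (fun z => Real.posLog (ρ * ‖z‖)) U := by
  have hc : Continuous fun z : ℂ => Real.posLog (ρ * ‖z‖) :=
    Real.continuous_posLog.comp (by fun_prop)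
  have e : ∀ z : ℂ, ρ * ‖z‖ = ‖(ρ : ℂ) * z‖ := fun z => by
    rw [norm_mul, Complex.norm_real, Real.norm_of_nonneg hρ.le]
  refine isSubharmonicOn_of_continuousOn hc.continuousOn fun z r hr _ _ => ?_
  simp_rw [e]
  rw [circleAverage_comp_mul (fun z => Real.posLog ‖z‖)]
  exact posLog_norm_le_circleAverage _ (mul_pos hr (by simpa using hρ.ne'))

lemma isSubharmonicOn_posLog_mul_inv_norm {ρ : ℝ} (hρ : 0 < ρ) {U : Set ℂ} (hU : (0 : ℂ) ∉ U) :
    IsSubharmonicOn (fun z => Real.posLog (ρ * ‖z‖⁻¹)) U := by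
  have hne : ∀ z ∈ U, ‖z‖ ≠ 0 := fun z hz h => hU (by rwa [norm_eq_zero.1 h] at hz)
  have hc : ContinuousOn (fun z : ℂ => Real.posLog (ρ * ‖z‖⁻¹)) U :=
    Real.continuous_posLog.comp_continuousOn
      (continuousOn_const.mul (continuous_norm.continuousOn.inv₀ hne))
  refine isSubharmonicOn_of_continuousOn hc fun z r hr hzr hint => ?_
  rw [Real.posLog_apply]
  refine max_le (circleAverage_posLog_nonneg _ _ _) ?_
  have hrz : r < ‖z‖ := by
    by_contra! h
    exact hU (hzr (by simpa using h))
  have i1 := circleIntegrable_log_norm hr hrz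
  have e : ∀ w ∈ U, Real.log (ρ * ‖w‖⁻¹) = Real.log ρ - Real.log ‖w‖ := fun w hw => by
    rw [Real.log_mul hρ.ne' (inv_ne_zero (hne w hw)), Real.log_inv, sub_eq_add_neg]
  rw [e z (hzr (mem_closedBall_self hr.le))]
  have h4 : circleAverage (fun z : ℂ => Real.log ρ - Real.log ‖z‖) z r =
      Real.log ρ - Real.log ‖z‖ := by
    rw [circleAverage_fun_sub (circleIntegrable_const _ _ _) i1, circleAverage_const,
      circleAverage_log_norm_eq hr hrz]
  rw [← h4]
  refine circleAverage_mono ((circleIntegrable_const _ _ _).sub i1) hint fun w hw => ?_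
  rw [abs_of_pos hr] at hw
  rw [← e w (hzr (sphere_subset_closedBall hw))]
  exact le_max_right _ _

/-- The Green function of the disc `|z| < ρ` with pole `0`, extended by zero. -/
noncomputable def discMinorant (ρ : ℝ) : Sphere → ℝ
  | none => 0
  | some z => Real.posLog (ρ * ‖z‖⁻¹)

/-- The Green function of the disc `|1 / z| < ρ` with pole `∞`, extended by zero. -/
noncomputable def discMinorantInfty (ρ : ℝ) : Sphere → ℝ
  | none => 0
  | some z => Real.posLog (ρ * ‖z‖)

lemma discMinorant_coe (ρ : ℝ) (z : ℂ) :
    discMinorant ρ (z : Sphere) = Real.posLog (ρ * ‖z‖⁻¹) := rfl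

lemma discMinorantInfty_coe (ρ : ℝ) (z : ℂ) :
    discMinorantInfty ρ (z : Sphere) = Real.posLog (ρ * ‖z‖) := rfl

lemma discMinorant_invChart (ρ : ℝ) (w : ℂ) :
    discMinorant ρ (invChart w) = Real.posLog (ρ * ‖w‖) := by
  rcases eq_or_ne w 0 with rfl | hw
  · rw [invChart_zero, norm_zero, mul_zero, Real.posLog_zero]; rfl
  · rw [invChart_of_ne hw, discMinorant_coe, norm_inv, inv_inv]

lemma discMinorantInfty_invChart (ρ : ℝ) (w : ℂ) :
    discMinorantInfty ρ (invChart w) = Real.posLog (ρ * ‖w‖⁻¹) := by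
  rcases eq_or_ne w 0 with rfl | hw
  · rw [invChart_zero, norm_zero, inv_zero, mul_zero, Real.posLog_zero]; rfl
  · rw [invChart_of_ne hw, discMinorantInfty_coe, norm_inv]

lemma posLog_mul_inv_eq_zero {ρ s : ℝ} (hρ : 0 < ρ) (hs : ρ < s) : Real.posLog (ρ * s⁻¹) = 0 := by
  have hs0 := hρ.trans hs
  rw [Real.posLog_eq_zero_iff, abs_of_pos (by positivity), ← div_eq_mul_inv, div_le_one hs0]
  exact hs.le

lemma le_posLog_mul_inv {ρ s : ℝ} (hρ : 0 < ρ) (hs : 0 < s) :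
    Real.log ρ ≤ Real.posLog (ρ * s⁻¹) + Real.log s := by
  have : Real.log (ρ * s⁻¹) ≤ Real.posLog (ρ * s⁻¹) := le_max_right _ _
  rw [Real.log_mul hρ.ne' (by positivity), Real.log_inv] at this
  linarith

lemma eventually_posLog_mul_inv_add_log_le {ρ : ℝ} (hρ : 0 < ρ) :
    ∀ᶠ ζ in 𝓝[≠] (0 : ℂ), Real.posLog (ρ * ‖ζ‖⁻¹) + Real.log ‖ζ‖ ≤ Real.log ρ := by
  have : ∀ᶠ ζ in 𝓝[≠] (0 : ℂ), ‖ζ‖ < ρ :=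
    nhdsWithin_le_nhds (continuous_norm.continuousAt.eventually_lt_const (by simpa using hρ))
  filter_upwards [this, self_mem_nhdsWithin] with ζ h hζ
  have hs : 0 < ‖ζ‖ := norm_pos_iff.2 hζ
  rw [Real.posLog_eq_log, Real.log_mul hρ.ne' (by positivity), Real.log_inv]
  · linarith
  · rw [abs_of_pos (by positivity), ← div_eq_mul_inv, le_div_iff₀ hs]; linarith

lemma isGreenMinorant_discMinorant {B : Set Sphere} {ρ : ℝ} (hρ : 0 < ρ)
    (hB : ∀ z : ℂ, ‖z‖ ≤ ρ → (z : Sphere) ∈ B) :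
    IsGreenMinorant B ((0 : ℂ) : Sphere) (discMinorant ρ) := by
  refine ⟨?_, ⟨?_, ?_⟩, ?_, Real.log ρ, ?_⟩
  · rintro (_ | z)
    · exact le_rfl
    · exact Real.posLog_nonneg
  · simp_rw [discMinorant_coe]
    exact isSubharmonicOn_posLog_mul_inv_norm hρ (by simp)
  · simp_rw [discMinorant_invChart]
    exact isSubharmonicOn_posLog_mul_norm hρ _
  · refine ⟨(fun z : ℂ => (z : Sphere)) '' closedBall 0 ρ,
      (isCompact_closedBall _ _).image OnePoint.continuous_coe, ?_, ?_⟩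
    · rintro _ ⟨z, hz, rfl⟩
      exact hB z (by simpa using hz)
    · rintro (_ | z) hz
      · rfl
      · refine posLog_mul_inv_eq_zero hρ (not_le.1 fun h => hz ⟨z, by simpa using h, rfl⟩)
  · simp_rw [localParam_zero, discMinorant_coe]
    exact eventually_posLog_mul_inv_add_log_le hρ

lemma isGreenMinorant_discMinorantInfty {B : Set Sphere} {ρ : ℝ} (hρ : 0 < ρ)
    (hB : ∀ w : ℂ, ‖w‖ ≤ ρ → invChart w ∈ B) :
    IsGreenMinorant B OnePoint.infty (discMinorantInfty ρ) := by
  refine ⟨?_, ⟨?_, ?_⟩, ?_, Real.log ρ, ?_⟩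
  · rintro (_ | z)
    · exact le_rfl
    · exact Real.posLog_nonneg
  · simp_rw [discMinorantInfty_coe]
    exact isSubharmonicOn_posLog_mul_norm hρ _
  · simp_rw [discMinorantInfty_invChart]
    exact isSubharmonicOn_posLog_mul_inv_norm hρ (by simp [invChart_zero])
  · refine ⟨invChart '' closedBall 0 ρ,
      (isCompact_closedBall _ _).image continuous_invChart, ?_, ?_⟩
    · rintro _ ⟨z, hz, rfl⟩
      exact hB z (by simpa using hz)
    · rintro (_ | z) hz
      · rfl
      · change Real.posLog (ρ * ‖z‖) = 0
        by_cases hz0 : z = 0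
        · simp [hz0]
        have := posLog_mul_inv_eq_zero (s := ‖z⁻¹‖) hρ (not_le.1 fun h => hz
          ⟨z⁻¹, by simpa using h, invChart_inv hz0⟩)
        rwa [norm_inv, inv_inv] at this
  · simp_rw [localParam_infty, discMinorantInfty_invChart]
    exact eventually_posLog_mul_inv_add_log_le hρ

lemma le_innerRadius_of_minorant {B : Set Sphere} {a : Sphere} {v : Sphere → ℝ} {ρ : ℝ}
    (hρ : 0 < ρ) (hv : IsGreenMinorant B a v)
    (h : ∀ ζ : ℂ, ζ ≠ 0 → v (localParam a ζ) = Real.posLog (ρ * ‖ζ‖⁻¹)) :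
    ENNReal.ofReal ρ ≤ innerRadius B a := by
  have h1 : ((Real.log ρ : ℝ) : EReal) ≤ limsup
      (fun ζ : ℂ => greenFunction B a (localParam a ζ) + (Real.log ‖ζ‖ : ℝ)) (𝓝[≠] (0 : ℂ)) := by
    refine le_limsup_of_frequently_le (Eventually.frequently ?_)
    filter_upwards [self_mem_nhdsWithin] with ζ hζ
    have h2 : ((v (localParam a ζ) : ℝ) : EReal) ≤ greenFunction B a (localParam a ζ) :=
      le_iSup (fun v : {v : Sphere → ℝ // IsGreenMinorant B a v} =>
        ((v.1 (localParam a ζ) : ℝ) : EReal)) ⟨v, hv⟩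
    refine le_trans ?_ (add_le_add_left h2 _)
    rw [← EReal.coe_add, EReal.coe_le_coe_iff, h ζ hζ]
    exact le_posLog_mul_inv hρ (norm_pos_iff.2 hζ)
  have h2 := EReal.exp_monotone h1
  rwa [EReal.exp_coe, Real.exp_log hρ] at h2

lemma le_innerRadius_zero {B : Set Sphere} {ρ : ℝ} (hρ : 0 < ρ)
    (hB : ∀ z : ℂ, ‖z‖ ≤ ρ → (z : Sphere) ∈ B) :
    ENNReal.ofReal ρ ≤ innerRadius B ((0 : ℂ) : Sphere) :=
  le_innerRadius_of_minorant hρ (isGreenMinorant_discMinorant hρ hB)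
    fun ζ _ => by rw [localParam_zero, discMinorant_coe]

lemma le_innerRadius_infty {B : Set Sphere} {ρ : ℝ} (hρ : 0 < ρ)
    (hB : ∀ w : ℂ, ‖w‖ ≤ ρ → invChart w ∈ B) :
    ENNReal.ofReal ρ ≤ innerRadius B OnePoint.infty :=
  le_innerRadius_of_minorant hρ (isGreenMinorant_discMinorantInfty hρ hB)
    fun ζ _ => by rw [localParam_infty, discMinorantInfty_invChart]

/-! ### The inner radii of two disjoint domains -/

/-- Around each point `z` of a compact subset of an open set there is a disc in the open set, whose
radius is a fixed proportion of `‖z‖`. -/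
lemma exists_relative_radius {K Ω : Set ℂ} (hK : IsCompact K) (hΩ : IsOpen Ω) (hKΩ : K ⊆ Ω) :
    ∃ δ > 0, δ < 1 ∧ ∀ z ∈ K, closedBall z (δ * ‖z‖) ⊆ Ω := by
  obtain ⟨d, hd, hdΩ⟩ := hK.exists_cthickening_subset_open hΩ hKΩ
  obtain ⟨R, hR0, hR⟩ := hK.isBounded.exists_pos_norm_le
  refine ⟨min (1 / 2) (d / R), by positivity, (min_le_left _ _).trans_lt (by norm_num), ?_⟩
  intro z hz
  refine Subset.trans ?_ ((closedBall_subset_cthickening hz d).trans hdΩ)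
  refine closedBall_subset_closedBall ?_
  calc min (1 / 2) (d / R) * ‖z‖ ≤ d / R * R := by
        gcongr
        · exact min_le_right _ _
        · exact hR z hz
    _ = d := div_mul_cancel₀ _ hR0.ne'

/-- A nonnegative function that is subharmonic on `Ω \ {0}`, vanishes outside a compact subset of
`Ω` and has at most a logarithmic pole satisfies `PuncturedMinorant`. -/
lemma PuncturedMinorant.of_isSubharmonicOn {f : ℂ → ℝ} {K Ω : Set ℂ} (hΩ : IsOpen Ω)
    (hK : IsCompact K) (hKΩ : K ⊆ Ω) (hf0 : ∀ z, 0 ≤ f z) (hfK : ∀ z, z ∉ K → f z = 0)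
    (hf : IsSubharmonicOn f (Ω \ {0}))
    (hlog : ∃ M : ℝ, ∀ᶠ z in 𝓝[≠] (0 : ℂ), f z + Real.log ‖z‖ ≤ M) : PuncturedMinorant f K := by
  refine ⟨hf0, ?_, hK, hfK, ?_, hlog⟩
  · intro z hz
    by_cases hzK : z ∈ K
    · have hzΩ : z ∈ Ω \ {0} := ⟨hKΩ hzK, hz⟩
      have hopen : IsOpen (Ω \ {0}) := hΩ.sdiff isClosed_singleton
      have := hf.usc z hzΩ
      intro y hy
      have h2 := this y hy
      rw [hopen.nhdsWithin_eq hzΩ] at h2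
      exact nhdsWithin_le_nhds h2
    · intro y hy
      rw [hfK z hzK] at hy
      refine nhdsWithin_le_nhds ?_
      filter_upwards [hK.isClosed.isOpen_compl.mem_nhds hzK] with w hw
      rwa [hfK w hw]
  · obtain ⟨δ, hδ, hδ1, hδΩ⟩ := exists_relative_radius hK hΩ hKΩ
    refine ⟨δ, hδ, hδ1, fun z hz r hr hrδ => ?_⟩
    have hn : 0 < ‖z‖ := norm_pos_iff.2 hz
    by_cases hzK : z ∈ K
    · refine hf.le_circleAverage z (r * ‖z‖) (by positivity) fun w hw => ⟨?_, ?_⟩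
      · refine hδΩ z hzK (closedBall_subset_closedBall ?_ hw)
        gcongr
      · rintro rfl
        rw [mem_closedBall, dist_zero_left] at hw
        nlinarith
    · rw [hfK z hzK]
      exact circleAverage_nonneg_of_nonneg fun w _ => hf0 w

/-- Two disjoint open sets of the sphere containing `0` and `∞`: traces of the elements of the two
Perron families satisfy the support condition of `mul_radialMean_add_le`. -/
lemma exists_radius_mul_circleAverage {B₁ B₂ : Set Sphere} (hB₁ : IsOpen B₁) (hB₂ : IsOpen B₂)
    (hd : Disjoint B₁ B₂) {v₁ v₂ : Sphere → ℝ}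
    {K₁ K₂ : Set ℂ} (h₁ : PuncturedMinorant (fun z : ℂ => v₁ z) K₁)
    (hK₁ : ∀ z ∈ K₁, (z : Sphere) ∈ B₁) (hv₁ : ∀ z, z ∉ B₁ → v₁ z = 0)
    (h₂ : PuncturedMinorant (fun w : ℂ => v₂ (invChart w)) K₂) (hK₂ : ∀ w ∈ K₂, invChart w ∈ B₂)
    (hv₂ : ∀ z, z ∉ B₂ → v₂ z = 0)
    (hs₂ : IsSubharmonicOn (fun z : ℂ => v₂ z) ((fun z : ℂ => (z : Sphere)) ⁻¹' B₂)) :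
    ∃ δ > 0, ∀ r, 0 < r → r ≤ δ → ∀ z : ℂ, z ≠ 0 →
      (v₁ z - v₂ (invChart z⁻¹)) * (v₁ z - v₂ (invChart z⁻¹)) ≤
      (v₁ z - v₂ (invChart z⁻¹)) *
        circleAverage (fun z : ℂ => v₁ z - v₂ (invChart z⁻¹)) z (r * ‖z‖) := by
  obtain ⟨δ₁, hδ₁, hδ₁1, hδ₁B⟩ := exists_relative_radius h₁.isCompact
    (hB₁.preimage OnePoint.continuous_coe) hK₁
  obtain ⟨δ₂, hδ₂, hδ₂1, hδ₂B⟩ := exists_relative_radius h₂.isCompact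
    (hB₂.preimage continuous_invChart) hK₂
  obtain ⟨δ₃, hδ₃, hδ₃1, hsub⟩ := h₁.submean
  refine ⟨min (min δ₁ δ₃) (δ₂ / 2), by positivity, fun r hr hrδ z hz => ?_⟩
  have hrδ₁ : r ≤ δ₁ := hrδ.trans ((min_le_left _ _).trans (min_le_left _ _))
  have hrδ₃ : r ≤ δ₃ := hrδ.trans ((min_le_left _ _).trans (min_le_right _ _))
  have hrδ₂ : r ≤ δ₂ / 2 := hrδ.trans (min_le_right _ _)
  have hn : 0 < ‖z‖ := norm_pos_iff.2 hz
  have hball : ∀ w ∈ closedBall z (r * ‖z‖), ‖z‖ / 2 < ‖w‖ := by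
    intro w hw
    rw [mem_closedBall_iff_norm] at hw
    have := norm_le_norm_add_norm_sub w z
    have : r * ‖z‖ < 1 / 2 * ‖z‖ := mul_lt_mul_of_pos_right (by linarith) hn
    linarith
  have hball0 : ∀ w ∈ closedBall z (r * ‖z‖), w ≠ 0 := fun w hw =>
    norm_pos_iff.1 ((by positivity : (0 : ℝ) < ‖z‖ / 2).trans (hball w hw))
  have hsph : sphere z |r * ‖z‖| ⊆ closedBall z (r * ‖z‖) := by
    rw [abs_of_pos (by positivity)]; exact sphere_subset_closedBall
  by_cases hz₁ : z ∈ K₁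
  · have hz₂ : ∀ w ∈ closedBall z (r * ‖z‖), v₂ (invChart w⁻¹) = 0 := by
      intro w hw
      rw [invChart_inv (hball0 w hw)]
      refine hv₂ _ (hd.notMem_of_mem_left (hδ₁B z hz₁ (closedBall_subset_closedBall ?_ hw)))
      gcongr
    rw [circleAverage_congr_sphere (f₂ := fun w : ℂ => v₁ w)
      fun w hw => by simp only [hz₂ w (hsph hw), sub_zero]]
    rw [hz₂ z (mem_closedBall_self (by positivity)), sub_zero]
    exact mul_le_mul_of_nonneg_left (hsub z hz r hr hrδ₃) (h₁.nonneg z)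
  by_cases hz₂ : z⁻¹ ∈ K₂
  · have hin : closedBall z (r * ‖z‖) ⊆ (fun z : ℂ => (z : Sphere)) ⁻¹' B₂ := by
      intro w hw
      have hw0 := hball0 w hw
      have hw2 := hball w hw
      have hwn : 0 < ‖w‖ := norm_pos_iff.2 hw0
      rw [mem_preimage, ← invChart_inv hw0]
      refine hδ₂B _ hz₂ ?_
      rw [mem_closedBall_iff_norm] at hw ⊢
      have e : w⁻¹ - z⁻¹ = -((w - z) * (w⁻¹ * z⁻¹)) := by field_simp; ring
      rw [e, norm_neg, norm_mul, norm_mul, norm_inv, norm_inv, ← mul_assoc]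
      refine mul_le_mul_of_nonneg_right ?_ (by positivity)
      rw [← div_eq_mul_inv, div_le_iff₀ hwn]
      calc ‖w - z‖ ≤ r * ‖z‖ := hw
        _ ≤ δ₂ / 2 * ‖z‖ := by gcongr
        _ ≤ δ₂ * ‖w‖ := by nlinarith
    have hz₁' : ∀ w ∈ closedBall z (r * ‖z‖), v₁ w = 0 := fun w hw =>
      hv₁ _ (hd.notMem_of_mem_right (hin hw))
    have e : circleAverage (fun z : ℂ => v₁ z - v₂ (invChart z⁻¹)) z (r * ‖z‖) =
        -circleAverage (fun z : ℂ => v₂ z) z (r * ‖z‖) := by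
      have h := circleAverage_fun_smul (a := (-1 : ℝ)) (f := fun z : ℂ => v₂ z) (c := z)
        (R := r * ‖z‖)
      simp only [smul_eq_mul, neg_one_mul] at h
      rw [← h]
      refine circleAverage_congr_sphere fun w hw => ?_
      simp only [hz₁' w (hsph hw), invChart_inv (hball0 w (hsph hw)), zero_sub]
    rw [e, hz₁' z (mem_closedBall_self (by positivity)), invChart_inv hz, zero_sub, neg_mul_neg,
      neg_mul_neg]
    have h0 : 0 ≤ v₂ z := by rw [← invChart_inv hz]; exact h₂.nonneg z⁻¹
    exact mul_le_mul_of_nonneg_left (hs₂.le_circleAverage z _ (by positivity) hin) h0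
  · have e1 := h₁.eq_zero z hz₁
    have e2 := h₂.eq_zero _ hz₂
    rw [e1, e2]; simp

lemma exists_common_radius {B₁ B₂ : Set Sphere} (hB₁ : IsOpen B₁) (hB₂ : IsOpen B₂)
    (h₁ : ((0 : ℂ) : Sphere) ∈ B₁) (h₂ : OnePoint.infty ∈ B₂) :
    ∃ ρ > 0, (∀ z : ℂ, ‖z‖ ≤ ρ → (z : Sphere) ∈ B₁) ∧ ∀ w : ℂ, ‖w‖ ≤ ρ → invChart w ∈ B₂ := by
  obtain ⟨ρ₁, hρ₁, h₁⟩ := Metric.nhds_basis_closedBall.mem_iff.1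
    ((hB₁.preimage OnePoint.continuous_coe).mem_nhds (show (0 : ℂ) ∈ _ from h₁))
  obtain ⟨ρ₂, hρ₂, h₂⟩ := Metric.nhds_basis_closedBall.mem_iff.1
    ((hB₂.preimage continuous_invChart).mem_nhds
      (show (0 : ℂ) ∈ _ by rw [mem_preimage, invChart_zero]; exact h₂))
  refine ⟨min ρ₁ ρ₂, lt_min hρ₁ hρ₂, fun z hz => h₁ ?_, fun w hw => h₂ ?_⟩
  · simpa using hz.trans (min_le_left _ _)
  · simpa using hw.trans (min_le_right _ _)

lemma isGreenMinorant_eq_zero {B : Set Sphere} {a : Sphere} {v : Sphere → ℝ}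
    (hv : IsGreenMinorant B a v) {z : Sphere} (hz : z ∉ B) : v z = 0 := by
  obtain ⟨K, -, hKB, hK⟩ := hv.compact_support
  exact hK z fun h => hz (hKB h)

/-- The trace of a Perron function in a chart `χ` centred at the pole. -/
lemma IsGreenMinorant.puncturedMinorant {B : Set Sphere} {a : Sphere} {v : Sphere → ℝ}
    (hB : IsOpen B) (hv : IsGreenMinorant B a v) {χ : ℂ → Sphere} (hχ : Continuous χ)
    (hbdd : Bornology.IsBounded (χ ⁻¹' B))
    (hs : IsSubharmonicOn (fun z => v (χ z)) ((χ ⁻¹' B) \ {0}))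
    (hlog : ∃ M : ℝ, ∀ᶠ z in 𝓝[≠] (0 : ℂ), v (χ z) + Real.log ‖z‖ ≤ M) :
    ∃ K, K ⊆ χ ⁻¹' B ∧ PuncturedMinorant (fun z => v (χ z)) K := by
  obtain ⟨K, hK, hKB, hK0⟩ := hv.compact_support
  have hKc : IsCompact (χ ⁻¹' K) :=
    Metric.isCompact_of_isClosed_isBounded (hK.isClosed.preimage hχ)
      (hbdd.subset (preimage_mono hKB))
  exact ⟨χ ⁻¹' K, preimage_mono hKB, PuncturedMinorant.of_isSubharmonicOn (hB.preimage hχ) hKc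
    (preimage_mono hKB) (fun z => hv.nonneg _) (fun z hz => hK0 _ hz) hs hlog⟩

/-- A priori upper bound, for a Perron function of a domain bounded in the chart. -/
lemma PuncturedMinorant.le_max {f : ℂ → ℝ} {K : Set ℂ} (hf : PuncturedMinorant f K) {R c : ℝ}
    (hR : 0 < R) (hK : K ⊆ ball 0 R) (hc : Real.log R ≤ c) {z : ℂ} (hz : z ≠ 0) :
    f z ≤ max 0 (c - Real.log ‖z‖) := by
  by_cases h : ‖z‖ ≤ R
  · have := hf.add_log_le hR hK hz h
    exact le_max_of_le_right (by linarith)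
  · rw [hf.eq_zero z fun hzK => h (mem_ball_zero_iff.1 (hK hzK)).le]
    exact le_max_left _ _

lemma frequently_exists_minorant {B : Set Sphere} {a : Sphere} {m : ℝ}
    (hm : (m : EReal) < limsup
      (fun ζ : ℂ => greenFunction B a (localParam a ζ) + (Real.log ‖ζ‖ : ℝ)) (𝓝[≠] (0 : ℂ)))
    {ρ : ℝ} (hρ : 0 < ρ) :
    ∃ v, IsGreenMinorant B a v ∧ ∃ ζ : ℂ, ζ ≠ 0 ∧ ‖ζ‖ < ρ ∧
      m ≤ v (localParam a ζ) + Real.log ‖ζ‖ := by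
  have h1 := frequently_lt_of_lt_limsup (by isBoundedDefault) hm
  have h2 : ∀ᶠ ζ in 𝓝[≠] (0 : ℂ), ζ ≠ 0 ∧ ‖ζ‖ < ρ := by
    have : ∀ᶠ ζ in 𝓝[≠] (0 : ℂ), ‖ζ‖ < ρ :=
      nhdsWithin_le_nhds (continuous_norm.continuousAt.eventually_lt_const (by simpa using hρ))
    filter_upwards [this, self_mem_nhdsWithin] with ζ h hζ using ⟨hζ, h⟩
  obtain ⟨ζ, hζ, hζ0, hζρ⟩ := (h1.and_eventually h2).exists
  have h3 : ((m - Real.log ‖ζ‖ : ℝ) : EReal) < greenFunction B a (localParam a ζ) := by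
    rw [EReal.coe_sub]
    exact EReal.sub_lt_of_lt_add hζ
  obtain ⟨⟨v, hv⟩, hlt⟩ := lt_iSup_iff.1 h3
  refine ⟨v, hv, ζ, hζ0, hζρ, ?_⟩
  have := EReal.coe_lt_coe_iff.1 hlt
  linarith

/-- The logarithmic form of the inequality for the inner radii of two disjoint domains. -/
theorem limsup_add_limsup_le {B₁ B₂ : Set Sphere} (hB₁ : IsOpen B₁) (hB₂ : IsOpen B₂)
    (h₁ : ((0 : ℂ) : Sphere) ∈ B₁) (h₂ : OnePoint.infty ∈ B₂) (hd : Disjoint B₁ B₂) {m₁ m₂ : ℝ}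
    (hm₁ : (m₁ : EReal) < limsup (fun ζ : ℂ => greenFunction B₁ ((0 : ℂ) : Sphere)
      (localParam ((0 : ℂ) : Sphere) ζ) + (Real.log ‖ζ‖ : ℝ)) (𝓝[≠] (0 : ℂ)))
    (hm₂ : (m₂ : EReal) < limsup (fun ζ : ℂ => greenFunction B₂ OnePoint.infty
      (localParam OnePoint.infty ζ) + (Real.log ‖ζ‖ : ℝ)) (𝓝[≠] (0 : ℂ))) :
    m₁ + m₂ ≤ 0 := by
  obtain ⟨ρ, hρ, hρ₁, hρ₂⟩ := exists_common_radius hB₁ hB₂ h₁ h₂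
  have hsub₁ : (fun z : ℂ => (z : Sphere)) ⁻¹' B₁ ⊆ ball 0 (2 / ρ) := by
    intro z hz
    by_contra h
    rw [mem_ball_zero_iff, not_lt] at h
    have hz0 : z ≠ 0 := norm_pos_iff.1 ((by positivity : 0 < 2 / ρ).trans_le h)
    refine hd.notMem_of_mem_left hz ?_
    change (z : Sphere) ∈ B₂
    rw [← invChart_inv hz0]
    refine hρ₂ _ ?_
    rw [norm_inv, inv_le_comm₀ (norm_pos_iff.2 hz0) hρ]
    refine le_trans ?_ h
    rw [inv_eq_one_div]; gcongr; norm_num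
  have hsub₂ : invChart ⁻¹' B₂ ⊆ ball 0 (2 / ρ) := by
    intro z hz
    by_contra h
    rw [mem_ball_zero_iff, not_lt] at h
    have hz0 : z ≠ 0 := norm_pos_iff.1 ((by positivity : 0 < 2 / ρ).trans_le h)
    refine hd.notMem_of_mem_right hz ?_
    rw [invChart_of_ne hz0]
    refine hρ₁ _ ?_
    rw [norm_inv, inv_le_comm₀ (norm_pos_iff.2 hz0) hρ]
    refine le_trans ?_ h
    rw [inv_eq_one_div]; gcongr; norm_num
  set c := max 1 (max (Real.log (2 / ρ)) (-Real.log ρ)) with hc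
  have hc1 : 1 ≤ c := le_max_left _ _
  have hcR : Real.log (2 / ρ) ≤ c := (le_max_left _ _).trans (le_max_right _ _)
  have hcρ : -c ≤ Real.log ρ := by
    have : -Real.log ρ ≤ c := (le_max_right _ _).trans (le_max_right _ _)
    linarith
  refine add_nonpos_of_minorants hc1 fun ρ' hρ' => ?_
  obtain ⟨v₁, hv₁, ζ₁, hζ₁0, hζ₁ρ, hζ₁⟩ := frequently_exists_minorant hm₁ hρ'
  obtain ⟨v₂, hv₂, ζ₂, hζ₂0, hζ₂ρ, hζ₂⟩ := frequently_exists_minorant hm₂ hρ'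
  -- The maximum with the Green function of a fixed disc has the lower bound that is uniform in `ρ'`.
  have hw₁ := hv₁.sup (isGreenMinorant_discMinorant hρ hρ₁)
  have hw₂ := hv₂.sup (isGreenMinorant_discMinorantInfty hρ hρ₂)
  set w₁ : Sphere → ℝ := fun z => max (v₁ z) (discMinorant ρ z) with hw₁def
  set w₂ : Sphere → ℝ := fun z => max (v₂ z) (discMinorantInfty ρ z) with hw₂def
  obtain ⟨K₁, hK₁, hp₁⟩ := hw₁.puncturedMinorant hB₁ (χ := fun z : ℂ => (z : Sphere))
    OnePoint.continuous_coe (isBounded_ball.subset hsub₁)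
    (by rw [← preimage_coe_diff_zero]; exact hw₁.subharmonic.1)
    (by simpa only [localParam_zero] using hw₁.log_pole)
  obtain ⟨K₂, hK₂, hp₂⟩ := hw₂.puncturedMinorant hB₂ (χ := invChart)
    continuous_invChart (isBounded_ball.subset hsub₂)
    (by rw [← preimage_invChart_diff_infty]; exact hw₂.subharmonic.2)
    (by simpa only [localParam_infty] using hw₂.log_pole)
  have hR : 0 < 2 / ρ := by positivity
  refine ⟨fun z => w₁ z, fun w => w₂ (invChart w), K₁, K₂, ζ₁, ζ₂, hp₁, hp₂,
    fun z hz => hp₁.le_max hR (hK₁.trans hsub₁) hcR hz, fun z hz => ?_,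
    fun z hz => hp₂.le_max hR (hK₂.trans hsub₂) hcR hz, fun z hz => ?_, ?_,
    hζ₁0, hζ₁ρ, ?_, hζ₂0, hζ₂ρ, ?_⟩
  · have e1 : discMinorant ρ (z : Sphere) ≤ w₁ z := le_max_right _ _
    rw [discMinorant_coe] at e1
    linarith [le_posLog_mul_inv hρ (norm_pos_iff.2 hz)]
  · have e1 : discMinorantInfty ρ (invChart z) ≤ w₂ (invChart z) := le_max_right _ _
    rw [discMinorantInfty_invChart] at e1
    linarith [le_posLog_mul_inv hρ (norm_pos_iff.2 hz)]
  · refine exists_radius_mul_circleAverage hB₁ hB₂ hd hp₁ hK₁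
      (fun z hz => isGreenMinorant_eq_zero hw₁ hz) hp₂ hK₂
      (fun z hz => isGreenMinorant_eq_zero hw₂ hz) ?_
    rw [← preimage_coe_diff_infty]
    exact hw₂.subharmonic.1
  · rw [localParam_zero] at hζ₁
    have : v₁ ζ₁ ≤ w₁ ζ₁ := le_max_left _ _
    linarith
  · rw [localParam_infty] at hζ₂
    have : v₂ (invChart ζ₂) ≤ w₂ (invChart ζ₂) := le_max_left _ _
    linarith

/-- Finiteness of each inner radius comes from `limsup_add_limsup_le`, the other one being
bounded below. -/
theorem innerRadius_bounds {B₁ B₂ : Set Sphere} (hB₁ : IsOpen B₁) (hB₂ : IsOpen B₂)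
    (h₁ : ((0 : ℂ) : Sphere) ∈ B₁) (h₂ : OnePoint.infty ∈ B₂) (hd : Disjoint B₁ B₂) :
    (0 < innerRadius B₁ ((0 : ℂ) : Sphere) ∧ innerRadius B₁ ((0 : ℂ) : Sphere) < ⊤ ∧
      0 < innerRadius B₂ OnePoint.infty ∧ innerRadius B₂ OnePoint.infty < ⊤) ∧
      innerRadius B₁ ((0 : ℂ) : Sphere) * innerRadius B₂ OnePoint.infty ≤ 1 := by
  obtain ⟨ρ, hρ, hρ₁, hρ₂⟩ := exists_common_radius hB₁ hB₂ h₁ h₂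
  have hp₁ : 0 < innerRadius B₁ ((0 : ℂ) : Sphere) :=
    (ENNReal.ofReal_pos.2 hρ).trans_le (le_innerRadius_zero hρ hρ₁)
  have hp₂ : 0 < innerRadius B₂ OnePoint.infty :=
    (ENNReal.ofReal_pos.2 hρ).trans_le (le_innerRadius_infty hρ hρ₂)
  have key := @limsup_add_limsup_le B₁ B₂ hB₁ hB₂ h₁ h₂ hd
  unfold innerRadius at hp₁ hp₂ ⊢
  set L₁ := limsup (fun ζ : ℂ => greenFunction B₁ ((0 : ℂ) : Sphere)
      (localParam ((0 : ℂ) : Sphere) ζ) + (Real.log ‖ζ‖ : ℝ)) (𝓝[≠] (0 : ℂ))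
  set L₂ := limsup (fun ζ : ℂ => greenFunction B₂ OnePoint.infty
      (localParam OnePoint.infty ζ) + (Real.log ‖ζ‖ : ℝ)) (𝓝[≠] (0 : ℂ))
  have hb₁ : L₁ ≠ ⊥ := by rintro h; rw [h] at hp₁; simp at hp₁
  have hb₂ : L₂ ≠ ⊥ := by rintro h; rw [h] at hp₂; simp at hp₂
  obtain ⟨s₁, hs₁⟩ := EReal.lt_iff_exists_real_btwn.1 (bot_lt_iff_ne_bot.2 hb₁)
  obtain ⟨s₂, hs₂⟩ := EReal.lt_iff_exists_real_btwn.1 (bot_lt_iff_ne_bot.2 hb₂)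
  have ht₁ : L₁ ≠ ⊤ := by
    intro h
    have := @key (1 - s₂) s₂ (by rw [h]; exact EReal.coe_lt_top _) hs₂.2
    linarith
  have ht₂ : L₂ ≠ ⊤ := by
    intro h
    have := @key s₁ (1 - s₁) hs₁.2 (by rw [h]; exact EReal.coe_lt_top _)
    linarith
  clear_value L₁ L₂
  lift L₁ to ℝ using ⟨ht₁, hb₁⟩
  lift L₂ to ℝ using ⟨ht₂, hb₂⟩
  refine ⟨⟨hp₁, ?_, hp₂, ?_⟩, ?_⟩
  · simp
  · simp
  · rw [← EReal.exp_add, ← EReal.coe_add, EReal.exp_coe, ENNReal.ofReal_le_one, Real.exp_le_one_iff]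
    refine le_of_forall_pos_le_add fun ε hε => ?_
    have := @key (L₁ - ε / 2) (L₂ - ε / 2) (by norm_cast; linarith) (by norm_cast; linarith)
    linarith

/-! ### Polycylindrical domains and the unit polydisc -/

lemma isOpen_image_invChart_ball : IsOpen (invChart '' ball 0 1) := by
  have h : invChart '' ball 0 1 = ((fun z : ℂ => (z : Sphere)) '' closedBall 0 1)ᶜ := by
    ext z
    induction z using OnePoint.rec with
    | infty =>
      refine iff_of_true ⟨0, by simp, invChart_zero⟩ ?_
      rintro ⟨z, -, hz⟩
      exact OnePoint.coe_ne_infty z hz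
    | coe z =>
      constructor
      · rintro ⟨w, hw, hwz⟩ ⟨z', hz', hzz'⟩
        have hzz' : z' = z := OnePoint.coe_injective hzz'
        subst hzz'
        rcases eq_or_ne w 0 with rfl | hw0
        · rw [invChart_zero] at hwz
          exact OnePoint.infty_ne_coe z' hwz
        · rw [invChart_of_ne hw0] at hwz
          have hwz : w⁻¹ = z' := OnePoint.coe_injective hwz
          rw [← hwz, mem_closedBall_zero_iff, norm_inv] at hz'
          rw [mem_ball_zero_iff] at hw
          have := (one_lt_inv₀ (norm_pos_iff.2 hw0)).2 hw
          linarith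
      · intro hz
        have h1 : 1 < ‖z‖ := by
          by_contra! h
          exact hz ⟨z, by simpa using h, rfl⟩
        have hz0 : z ≠ 0 := norm_pos_iff.1 (by linarith)
        refine ⟨z⁻¹, ?_, invChart_inv hz0⟩
        rw [mem_ball_zero_iff, norm_inv]
        exact inv_lt_one_of_one_lt₀ h1
  rw [h, isOpen_compl_iff]
  exact ((isCompact_closedBall _ _).image OnePoint.continuous_coe).isClosed

/-- The unit polydisc as a polycylindrical domain. -/
def polydisc : PolycylindricalDomain where
  coord _ := (fun z : ℂ => (z : Sphere)) '' ball 0 1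
  isOpen_coord _ := OnePoint.isOpenEmbedding_coe.isOpenMap _ isOpen_ball
  isConnected_coord _ := ((convex_ball (0 : ℂ) 1).isConnected ⟨0, by simp⟩).image _
    OnePoint.continuous_coe.continuousOn

/-- The image of the unit polydisc under the coordinatewise inversion. -/
def invPolydisc : PolycylindricalDomain where
  coord _ := invChart '' ball 0 1
  isOpen_coord _ := isOpen_image_invChart_ball
  isConnected_coord _ := ((convex_ball (0 : ℂ) 1).isConnected ⟨0, by simp⟩).image _
    continuous_invChart.continuousOn

lemma carrier_polydisc : polydisc.carrier = unitPolydisc := by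
  ext Z
  refine forall_congr' fun k => ?_
  constructor
  · rintro ⟨z, hz, h⟩
    exact ⟨z, by simpa using hz, h.symm⟩
  · rintro ⟨z, hz, h⟩
    exact ⟨z, by simpa using hz, h.symm⟩

lemma carrier_invPolydisc : invPolydisc.carrier = coordInv '' polydisc.carrier := by
  ext Z
  constructor
  · intro h
    choose z hz hzZ using h
    refine ⟨fun k => (z k : Sphere), fun k => ⟨z k, hz k, rfl⟩, ?_⟩
    funext k
    exact hzZ k
  · rintro ⟨Y, hY, rfl⟩ k
    obtain ⟨z, hz, hzY⟩ := hY k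
    refine ⟨z, hz, ?_⟩
    rw [coordInv, ← hzY]
    rfl

lemma disjoint_polydisc_invPolydisc (k : ℕ) :
    Disjoint (polydisc.coord k) (invPolydisc.coord k) := by
  rw [Set.disjoint_left]
  rintro _ ⟨z, hz, rfl⟩ ⟨w, hw, h⟩
  rcases eq_or_ne w 0 with rfl | hw0
  · rw [invChart_zero] at h
    exact OnePoint.infty_ne_coe z h
  · rw [invChart_of_ne hw0] at h
    have h : w⁻¹ = z := OnePoint.coe_injective h
    rw [← h, mem_ball_zero_iff, norm_inv] at hz
    rw [mem_ball_zero_iff] at hw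
    have := (one_lt_inv₀ (norm_pos_iff.2 hw0)).2 hw
    linarith

lemma polydisc_mem_nonoverlappingPairs :
    (polydisc, invPolydisc) ∈ nonoverlappingPairs origin infinity :=
  ⟨fun _ => ⟨0, by simp, rfl⟩, fun _ => ⟨0, by simp, invChart_zero⟩, disjoint_polydisc_invPolydisc⟩

lemma one_le_of_forall_ofReal_le {x : ℝ≥0∞}
    (h : ∀ ρ : ℝ, 0 < ρ → ρ < 1 → ENNReal.ofReal ρ ≤ x) : 1 ≤ x := by
  refine le_of_forall_lt fun y hy => ?_
  obtain ⟨ρ, hρ, h1, h2⟩ := ENNReal.lt_iff_exists_real_btwn.1 hy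
  rw [ENNReal.ofReal_lt_one] at h2
  have hρ0 : 0 < ρ := ENNReal.ofReal_pos.1 (bot_le.trans_lt h1)
  exact h1.trans_le (h ρ hρ0 h2)

lemma generalizedInnerRadius_bounds {B₁ B₂ : PolycylindricalDomain}
    (h : (B₁, B₂) ∈ nonoverlappingPairs origin infinity) (k : ℕ) :
    (0 < generalizedInnerRadius B₁ origin k ∧ generalizedInnerRadius B₁ origin k < ⊤ ∧
      0 < generalizedInnerRadius B₂ infinity k ∧ generalizedInnerRadius B₂ infinity k < ⊤) ∧
      generalizedInnerRadius B₁ origin k * generalizedInnerRadius B₂ infinity k ≤ 1 :=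
  innerRadius_bounds (B₁.isOpen_coord k) (B₂.isOpen_coord k) (h.1 k) (h.2.1 k) (h.2.2 k)

lemma generalizedInnerRadius_polydisc_mul :
    generalizedInnerRadius polydisc origin * generalizedInnerRadius invPolydisc infinity = 1 := by
  funext k
  refine le_antisymm (generalizedInnerRadius_bounds polydisc_mem_nonoverlappingPairs k).2 ?_
  refine one_le_mul (one_le_of_forall_ofReal_le fun ρ hρ hρ1 => ?_)
    (one_le_of_forall_ofReal_le fun ρ hρ hρ1 => ?_)
  · exact le_innerRadius_zero hρ fun z hz => ⟨z, by simpa using hz.trans_lt hρ1, rfl⟩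
  · exact le_innerRadius_infty hρ fun w hw => ⟨w, by simpa using hw.trans_lt hρ1, rfl⟩

end PolyCyl

theorem theorem4 :
    (∀ B₁ B₂ : PolyCyl.PolycylindricalDomain,
      (B₁, B₂) ∈ PolyCyl.nonoverlappingPairs PolyCyl.origin PolyCyl.infinity →
        (∀ k, 0 < PolyCyl.generalizedInnerRadius B₁ PolyCyl.origin k ∧
          PolyCyl.generalizedInnerRadius B₁ PolyCyl.origin k < ⊤ ∧
          0 < PolyCyl.generalizedInnerRadius B₂ PolyCyl.infinity k ∧
          PolyCyl.generalizedInnerRadius B₂ PolyCyl.infinity k < ⊤) ∧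
        PolyCyl.generalizedInnerRadius B₁ PolyCyl.origin *
          PolyCyl.generalizedInnerRadius B₂ PolyCyl.infinity ≤ 1) ∧
    (∃ B₁ B₂ : PolyCyl.PolycylindricalDomain,
      (B₁, B₂) ∈ PolyCyl.nonoverlappingPairs PolyCyl.origin PolyCyl.infinity ∧
        B₁.carrier = PolyCyl.unitPolydisc ∧
        B₂.carrier = PolyCyl.coordInv '' B₁.carrier ∧
        PolyCyl.generalizedInnerRadius B₁ PolyCyl.origin *
          PolyCyl.generalizedInnerRadius B₂ PolyCyl.infinity = 1) := by
  refine ⟨fun B₁ B₂ h => ⟨fun k => (PolyCyl.generalizedInnerRadius_bounds h k).1,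
    fun k => (PolyCyl.generalizedInnerRadius_bounds h k).2⟩, PolyCyl.polydisc,
    PolyCyl.invPolydisc, PolyCyl.polydisc_mem_nonoverlappingPairs, PolyCyl.carrier_polydisc,
    PolyCyl.carrier_invPolydisc, PolyCyl.generalizedInnerRadius_polydisc_mul⟩
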